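/- Let $p$ be an odd prime with $p<2^5$ and $p\notin\{13,29\}$. Then there exists a Dehn $p$-colorable knot $K$ with $$\mathrm{mincol}^{\mathrm{Dehn}}_p(K)=\lfloor \log_2 p\rfloor+2 .$$ Here a knot is a tame knot in $\mathbb R^3$, i.e. a subset of $\mathbb{R}^3$ that is ambient isotopic to a simple closed polygon. A diagram $D$ of $K$ is a regular projection to the plane of a polygonal knot ambient isotopic to $K$ (all multiple points are transverse double points away from the vertices), together with the over/under information at each crossing. The regions of $D$ are the connected components of the complement of the projection in the plane. At a crossing, let $x_1,x_2,x_3,x_4$ be the four surrounding regions, where $x_2$ is adjacent to $x_1$ by an under-arc, $x_3$ is adjacent to $x_1$ by the over-arc, and $x_4$ is opposite to $x_1$. A Dehn $p$-coloring of $D$ is a map $C$ from the set of regions of $D$ to $\mathbb Z/p\mathbb Z$ with $C(x_1)+C(x_3)=C(x_2)+C(x_4)$ at every crossing. It is trivial if $C(x_1)=C(x_4)$ and $C(x_2)=C(x_3)$ at every crossing, and nontrivial otherwise. The knot $K$ is Dehn $p$-colorable if some diagram of $K$ has a nontrivial Dehn $p$-coloring, and in that case $\mathrm{mincol}^{\mathrm{Dehn}}_p(K)$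 is the minimum of $\#\,\mathrm{Im}\,C$ over all pairs $(D,C)$ of a diagram $D$ of $K$ and a nontrivial Dehn $p$-coloring $C$ of $D$. -/

import Mathlib

/-- Euclidean 3-space as (plane) × (height), with its usual topology. The first projection
`Prod.fst` is the vertical projection to the plane; the second coordinate is the height. -/
abbrev Space : Type := (ℝ × ℝ) × ℝ

/-- `K` and `K'` are ambient isotopic: a continuous path of homeomorphisms of 3-space starts at
the identity and ends at a homeomorphism that carries `K` onto `K'`. -/
def AmbientIsotopic (K K' : Set Space) : Prop :=
  ∃ H : unitInterval → (Space ≃ₜ Space),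
    Continuous (fun q : unitInterval × Space => H q.1 q.2) ∧
    H 0 = Homeomorph.refl Space ∧ H 1 '' K = K'

/-- A simple closed polygon in 3-space with `n ≥ 3` cyclically indexed vertices. A point of the
closed polygon is `(1 - s) • v i + s • v (i + 1)` for a unique edge `i` and `s ∈ [0, 1)`. -/
structure PolygonalKnot where
  n : ℕ
  three_le : 3 ≤ n
  vertex : ZMod n → Space
  simple : ∀ (i j : ZMod n) (s t : ℝ), s ∈ Set.Ico (0 : ℝ) 1 → t ∈ Set.Ico (0 : ℝ) 1 →
    AffineMap.lineMap (vertex i) (vertex (i + 1)) s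
      = AffineMap.lineMap (vertex j) (vertex (j + 1)) t → i = j ∧ s = t

namespace PolygonalKnot

/-- The point with parameter `s` on the `i`-th edge. -/
def point (P : PolygonalKnot) (i : ZMod P.n) (s : ℝ) : Space :=
  AffineMap.lineMap (P.vertex i) (P.vertex (i + 1)) s

/-- The polygon as a subset of 3-space. -/
def carrier (P : PolygonalKnot) : Set Space :=
  {x | ∃ (i : ZMod P.n) (s : ℝ), s ∈ Set.Ico (0 : ℝ) 1 ∧ P.point i s = x}

/-- The direction of the vertical projection of the `i`-th edge. -/
def dir (P : PolygonalKnot) (i : ZMod P.n) : ℝ × ℝ :=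
  (P.vertex (i + 1)).1 - (P.vertex i).1

/-- The vertical projection of the polygon to the plane. -/
def shadow (P : PolygonalKnot) : Set (ℝ × ℝ) := Prod.fst '' P.carrier

end PolygonalKnot

/-- A (tame) knot: a subset of 3-space that is ambient isotopic to a simple closed polygon. -/
def IsKnot (K : Set Space) : Prop := ∃ P : PolygonalKnot, AmbientIsotopic P.carrier K

/-- A knot diagram: the vertical projection of a polygonal knot, with the over/under information
given by the heights, where the projection is regular, i.e. its multiple points are
transverse double points away from the vertices. -/
structure KnotDiagram extends PolygonalKnot where
  transverse : ∀ (i j : ZMod n) (s t : ℝ), s ∈ Set.Ico (0 : ℝ) 1 → t ∈ Set.Ico (0 : ℝ) 1 →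
    (toPolygonalKnot.point i s).1 = (toPolygonalKnot.point j t).1 → (i, s) ≠ (j, t) →
    s ≠ 0 ∧ t ≠ 0 ∧
      LinearIndependent ℝ ![toPolygonalKnot.dir i, toPolygonalKnot.dir j]
  no_triple : ∀ (i j k : ZMod n) (s t u : ℝ),
    s ∈ Set.Ico (0 : ℝ) 1 → t ∈ Set.Ico (0 : ℝ) 1 → u ∈ Set.Ico (0 : ℝ) 1 →
    (toPolygonalKnot.point i s).1 = (toPolygonalKnot.point j t).1 →
    (toPolygonalKnot.point j t).1 = (toPolygonalKnot.point k u).1 →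
    (i, s) = (j, t) ∨ (j, t) = (k, u) ∨ (i, s) = (k, u)

namespace KnotDiagram

/-- `D` is a diagram of the knot `K`. -/
def IsDiagramOf (D : KnotDiagram) (K : Set Space) : Prop := AmbientIsotopic D.carrier K

/-- The regions of `D`: the connected components of the complement of the projection. -/
def Region (D : KnotDiagram) : Type :=
  ConnectedComponents {x : ℝ × ℝ // x ∉ D.shadow}

/-- The region of `D` that contains the point `x` of the complement of the projection. -/
def regionOf (D : KnotDiagram) (x : ℝ × ℝ) (hx : x ∉ D.shadow) : D.Region :=
  ConnectedComponents.mk (⟨x, hx⟩ : {x : ℝ × ℝ // x ∉ D.shadow})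

/-- The region seen from the point `c` in the direction `d`: the points `c + r • d` with
small `r > 0` lie in the region `R`. -/
def IsRegionAt (D : KnotDiagram) (c d : ℝ × ℝ) (R : D.Region) : Prop :=
  ∃ ε : ℝ, 0 < ε ∧ ∀ r : ℝ, 0 < r → r < ε →
    ∃ h : c + r • d ∉ D.shadow, D.regionOf (c + r • d) h = R

/-- The point with parameter `s` on edge `i` lies vertically above the point with parameter `t`
on edge `j`: a crossing, whose over-arc runs along edge `i` and whose under-arcs run
along edge `j`. -/
def IsCrossing (D : KnotDiagram) (i : ZMod D.n) (s : ℝ) (j : ZMod D.n) (t : ℝ) : Prop :=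
  s ∈ Set.Ico (0 : ℝ) 1 ∧ t ∈ Set.Ico (0 : ℝ) 1 ∧
    (D.point i s).1 = (D.point j t).1 ∧ (D.point j t).2 < (D.point i s).2

/-- `x₁, x₂, x₃, x₄` are the four regions around the crossing `(i, s, j, t)`: `x₂` is
adjacent to `x₁` by an under-arc (the half of the under-strand in direction `D.dir j`),
`x₃` is adjacent to `x₁` by the over-arc (its half in direction `D.dir i`), and
`x₄` is opposite to `x₁`. -/
def RegionsAround (D : KnotDiagram) (i : ZMod D.n) (s : ℝ) (j : ZMod D.n) (t : ℝ)
    (x₁ x₂ x₃ x₄ : D.Region) : Prop :=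
  D.IsCrossing i s j t ∧
    D.IsRegionAt (D.point i s).1 (D.dir i + D.dir j) x₁ ∧
    D.IsRegionAt (D.point i s).1 (-D.dir i + D.dir j) x₂ ∧
    D.IsRegionAt (D.point i s).1 (D.dir i - D.dir j) x₃ ∧
    D.IsRegionAt (D.point i s).1 (-D.dir i - D.dir j) x₄

/-- A Dehn `p`-coloring of `D`. -/
def IsDehnColoring (D : KnotDiagram) (p : ℕ) (C : D.Region → ZMod p) : Prop :=
  ∀ (i : ZMod D.n) (s : ℝ) (j : ZMod D.n) (t : ℝ) (x₁ x₂ x₃ x₄ : D.Region),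
    D.RegionsAround i s j t x₁ x₂ x₃ x₄ → C x₁ + C x₃ = C x₂ + C x₄

/-- A coloring is trivial if every crossing is trivially colored. -/
def IsTrivial (D : KnotDiagram) {p : ℕ} (C : D.Region → ZMod p) : Prop :=
  ∀ (i : ZMod D.n) (s : ℝ) (j : ZMod D.n) (t : ℝ) (x₁ x₂ x₃ x₄ : D.Region),
    D.RegionsAround i s j t x₁ x₂ x₃ x₄ → C x₁ = C x₄ ∧ C x₃ = C x₂

end KnotDiagram

/-- The knot `K` has a diagram with a nontrivial Dehn `p`-coloring. -/
def DehnColorable (p : ℕ) (K : Set Space) : Prop :=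
  ∃ (D : KnotDiagram) (C : D.Region → ZMod p),
    D.IsDiagramOf K ∧ D.IsDehnColoring p C ∧ ¬ D.IsTrivial C

/-- The minimum number of colors of `K` for Dehn `p`-colorings: the least number of elements of
the image of `C`, over all nontrivially Dehn `p`-colored diagrams `(D, C)` of `K`. -/
noncomputable def mincolDehn (p : ℕ) (K : Set Space) : ℕ :=
  sInf {m : ℕ | ∃ (D : KnotDiagram) (C : D.Region → ZMod p),
    D.IsDiagramOf K ∧ D.IsDehnColoring p C ∧ ¬ D.IsTrivial C ∧ (Set.range C).ncard = m}

/-! ### Minors and ranks -/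

/-! The lower bound compares ranks modulo 2 and modulo `p`. Take the `n` colors of a nontrivial
coloring, not the regions, as unknowns. Each crossing gives an integer row `e_{x₁} - e_{x₂} + e_{x₃}
- e_{x₄}` of a matrix `A`, and triviality is expressed by the rows `e_{x₁} - e_{x₄}` and `e_{x₃} -
e_{x₂}` of a matrix `B`. Since `B` is totally unimodular, its rank modulo `p` is at most its rank
modulo 2. Modulo 2 every solution of `A` is trivial, so `A` has at least the rank of `B`. Modulo `p`
the given coloring solves `A` but not `B`, so `A` has smaller rank than `B`. Hence a maximal
nonvanishing minor of `A` modulo 2 is a nonzero integer divisible by `p`. Its size `k` is at most `n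
- 1`, because constants solve `A`. Its absolute value is at most `2 ^ k`, because splitting every
row into two differences of unit vectors writes it as a sum of `2 ^ k` determinants equal to 0 or
±1. So `p ≤ 2 ^ (n - 1)` (`le_two_pow_of_relations`), strictly since `p` is odd, which is `⌊log₂ p⌋
+ 2 ≤ n`.

That a knot has only trivial Dehn 2-colorings (`KnotDiagram.isTrivial_of_two`) is the topological
input. Modulo 2 the crossing relation says that the sum of the colors on the two sides of a strand
does not change across a crossing, for the upper and the lower strand alike. As there is only one
component, this sum is one constant on the whole diagram, and then opposite regions at each crossing
agree. Turning this into a proof about plane polygons requires local pictures of the complement near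
an edge, a vertex and a crossing.

For the upper bound each of the primes 3, 5, 7, 11, 17, 19, 23, 31 gets an explicit closed braid,
drawn on the integer lattice with colored unit cells and using `⌊log₂ p⌋ + 2` colors. A finite check
(`latticeCheck`) guarantees that the polygon is a knot diagram, that the cell colors descend to its
regions, and that they form a nontrivial Dehn coloring. -/

/-- A matrix of rank `r` over a field has `r` linearly independent rows. -/
theorem Matrix.exists_linearIndependent_submatrix_row {F m n : Type*} [Field F] [Fintype m]
    [Fintype n] (M : Matrix m n F) {r : ℕ} (hr : M.rank = r) :
    ∃ f : Fin r → m, LinearIndependent F (M.submatrix f id).row := by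
  rw [M.rank_eq_finrank_span_row] at hr
  obtain ⟨f, hf, -, hli⟩ := Submodule.exists_fun_fin_finrank_span_eq F (Set.range M.row)
  choose e he using hf
  subst hr
  refine ⟨e, ?_⟩
  have : (M.submatrix e id).row = f := funext he
  rw [this]
  exact hli

/-- A matrix over a field has a nonvanishing minor whose size is its rank. -/
theorem Matrix.exists_det_submatrix_ne_zero {F m n : Type*} [Field F] [Fintype m] [Fintype n]
    (M : Matrix m n F) :
    ∃ (f : Fin M.rank → m) (g : Fin M.rank → n), (M.submatrix f g).det ≠ 0 := by
  classical
  obtain ⟨f, hf⟩ := M.exists_linearIndependent_submatrix_row rfl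
  obtain ⟨g, hg⟩ := (M.submatrix f id).transpose.exists_linearIndependent_submatrix_row
    (r := M.rank) (by rw [Matrix.rank_transpose, hf.rank_matrix, Fintype.card_fin])
  refine ⟨f, g, ?_⟩
  rw [← Matrix.det_transpose]
  exact ((Matrix.isUnit_iff_isUnit_det _).1 (Matrix.linearIndependent_rows_iff_isUnit.1 hg)).ne_zero

/-- The size of a nonvanishing minor is at most the rank. -/
theorem Matrix.le_rank_of_det_submatrix_ne_zero {F m n : Type*} [Field F] [Fintype n]
    (M : Matrix m n F) {k : ℕ} (f : Fin k → m) (g : Fin k → n)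
    (h : (M.submatrix f g).det ≠ 0) : k ≤ M.rank := by
  have h1 := Matrix.rank_of_det_ne_zero h
  have h2 := M.rank_submatrix_le f g
  rw [h1, Fintype.card_fin] at h2
  exact h2

/-- A matrix with a smaller kernel has a larger rank. -/
theorem Matrix.rank_le_rank_of_ker_le {F m m' n : Type*} [Field F] [Fintype n]
    (A : Matrix m n F) (B : Matrix m' n F)
    (h : ∀ v, A.mulVec v = 0 → B.mulVec v = 0) : B.rank ≤ A.rank := by
  have hle : A.mulVecLin.ker ≤ B.mulVecLin.ker := fun v hv => h v hv
  have h1 := LinearMap.finrank_range_add_finrank_ker A.mulVecLin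
  have h2 := LinearMap.finrank_range_add_finrank_ker B.mulVecLin
  have h3 := Submodule.finrank_mono hle
  rw [Matrix.rank, Matrix.rank]
  omega

/-- A matrix with a strictly smaller kernel has a strictly larger rank. -/
theorem Matrix.rank_lt_rank_of_ker_lt {F m m' n : Type*} [Field F] [Fintype n]
    (A : Matrix m n F) (B : Matrix m' n F)
    (h : ∀ v, B.mulVec v = 0 → A.mulVec v = 0) (v : n → F) (hA : A.mulVec v = 0)
    (hB : B.mulVec v ≠ 0) : A.rank < B.rank := by
  have hlt : B.mulVecLin.ker < A.mulVecLin.ker :=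
    lt_of_le_of_ne (fun v hv => h v hv) fun he => hB (show v ∈ B.mulVecLin.ker by rw [he]; exact hA)
  have h1 := LinearMap.finrank_range_add_finrank_ker A.mulVecLin
  have h2 := LinearMap.finrank_range_add_finrank_ker B.mulVecLin
  have h3 := Submodule.finrank_lt_finrank_of_lt hlt
  rw [Matrix.rank, Matrix.rank]
  omega

/-! ### Matrices whose rows are differences of unit vectors -/

/-- The row vector `e_a - e_b`. -/
def differenceRow {ι : Type*} [DecidableEq ι] (q : ι × ι) : ι → ℤ :=
  Pi.single q.1 1 - Pi.single q.2 1

/-- Difference rows form a totally unimodular matrix. -/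
theorem isTotallyUnimodular_differenceRow {ι : Type*} [DecidableEq ι] :
    (Matrix.of (differenceRow (ι := ι))).IsTotallyUnimodular := by
  intro k
  induction k with
  | zero => intro f g _ _; exact ⟨1, by simp⟩
  | succ k ih =>
    intro f g hf hg
    set M := (Matrix.of (differenceRow (ι := ι))).submatrix f g with hM
    -- The chosen columns are distinct, so a unit vector restricted to them is again a unit vector
    -- or vanishes.
    have hcol : ∀ c : ι, (∃ j₀, ∀ j, (Pi.single c 1 : ι → ℤ) (g j) = if j = j₀ then 1 else 0) ∨
        ∀ j, (Pi.single c 1 : ι → ℤ) (g j) = 0 := by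
      intro c
      by_cases hc : ∃ j₀, g j₀ = c
      · obtain ⟨j₀, rfl⟩ := hc
        exact Or.inl ⟨j₀, fun j => by simp [Pi.single_apply, hg.eq_iff]⟩
      · push Not at hc
        exact Or.inr fun j => by simp [hc j]
    -- If all row sums vanish, the all-ones vector is in the kernel and the determinant is 0. A row
    -- with nonzero sum has kept exactly one of its two entries, so expansion along it reduces to a
    -- smaller minor up to sign.
    by_cases hsum : ∀ i, ∑ j, M i j = 0
    · refine ⟨0, ?_⟩
      rw [SignType.coe_zero, eq_comm, ← Matrix.exists_mulVec_eq_zero_iff]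
      exact ⟨1, one_ne_zero, by ext i; simpa [Matrix.mulVec, dotProduct] using hsum i⟩
    · push Not at hsum
      obtain ⟨i, hi⟩ := hsum
      obtain ⟨j₀, ε, hε⟩ : ∃ (j₀ : Fin (k + 1)) (ε : SignType),
          ∀ j, M i j = if j = j₀ then (ε : ℤ) else 0 := by
        have hMi : ∀ j, M i j = (Pi.single (f i).1 1 : ι → ℤ) (g j)
          - (Pi.single (f i).2 1 : ι → ℤ) (g j) := fun j => by simp [hM, differenceRow]
        rcases hcol (f i).1 with ⟨j₁, h₁⟩ | h₁ <;> rcases hcol (f i).2 with ⟨j₂, h₂⟩ | h₂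
        · exact absurd (by simp [hMi, h₁, h₂]) hi
        · exact ⟨j₁, 1, fun j => by simp [hMi, h₁, h₂]⟩
        · exact ⟨j₂, -1, fun j => by by_cases hj : j = j₂ <;> simp [hMi, h₁, h₂, hj]⟩
        · exact absurd (by simp [hMi, h₁, h₂]) hi
      obtain ⟨δ, hδ⟩ := ih (f ∘ i.succAbove) (g ∘ j₀.succAbove)
        (hf.comp Fin.succAbove_right_injective) (hg.comp Fin.succAbove_right_injective)
      rw [Matrix.det_succ_row M i,
        Finset.sum_eq_single j₀ (by intro j _ hj; simp [hε, hj]) (by simp)]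
      have : (M.submatrix i.succAbove j₀.succAbove).det = (δ : ℤ) := by
        rw [hδ, hM, Matrix.submatrix_submatrix]
      rw [this, hε]
      rcases neg_one_pow_eq_or ℤ ((i : ℕ) + (j₀ : ℕ)) with h | h <;> rw [h]
      · exact ⟨ε * δ, by cases ε <;> cases δ <;> simp⟩
      · exact ⟨-(ε * δ), by cases ε <;> cases δ <;> simp⟩

/-- A matrix all of whose rows are sums of two difference rows has `k × k` minors at most `2 ^ k`. -/
theorem abs_det_le_two_pow {ι κ : Type*} [DecidableEq ι] (u v : κ → ι × ι) {k : ℕ}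
    (f : Fin k → κ) (g : Fin k → ι) :
    |((Matrix.of fun i => differenceRow (u i) + differenceRow (v i)).submatrix f g).det| ≤ 2 ^ k := by
  let r (q : ι × ι) : Fin k → ℤ := differenceRow q ∘ g
  -- Multilinearity in the rows: a term is a choice, for every row, of its `u` part or its `v` part,
  -- which gives `2 ^ k` determinants of difference rows.
  have hsplit : ((Matrix.of fun i => differenceRow (u i) + differenceRow (v i)).submatrix f g).det
      = ∑ s : Finset (Fin k), Matrix.det (Matrix.of (s.piecewise (r ∘ u ∘ f) (r ∘ v ∘ f))) :=
    (Matrix.detRowAlternating (R := ℤ) (n := Fin k)).toMultilinearMap.map_add_univ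
      (r ∘ u ∘ f) (r ∘ v ∘ f)
  rw [hsplit]
  refine (Finset.abs_sum_le_sum_abs _ _).trans ?_
  refine (Finset.sum_le_card_nsmul _ _ 1 fun s _ => ?_).trans (by simp)
  have h := (Matrix.isTotallyUnimodular_iff _).1 (isTotallyUnimodular_differenceRow (ι := ι)) k
    (s.piecewise (u ∘ f) (v ∘ f)) g
  have he : (Matrix.of (differenceRow (ι := ι))).submatrix (s.piecewise (u ∘ f) (v ∘ f)) g
      = Matrix.of (s.piecewise (r ∘ u ∘ f) (r ∘ v ∘ f)) := by
    ext i j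
    by_cases hi : i ∈ s <;> simp [hi, r]
  rw [he] at h
  obtain ⟨ε, hε⟩ := h
  rw [← hε]
  cases ε <;> simp

/-! ### The determinant bound for systems of crossing relations -/

/-- If `s` satisfies the relations `s x₁ + s x₃ = s x₂ + s x₄` modulo `p`, without satisfying
`s x₁ = s x₄` and `s x₃ = s x₂` throughout, while all solutions modulo `2` do, then the number of
unknowns is large. -/
theorem le_two_pow_of_relations.{u} {ι : Type u} [Fintype ι] {p : ℕ} [Fact p.Prime]
    (R : Set (ι × ι × ι × ι)) (s : ι → ZMod p)
    (hs : ∀ x₁ x₂ x₃ x₄, (x₁, x₂, x₃, x₄) ∈ R → s x₁ + s x₃ = s x₂ + s x₄)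
    (hs' : ¬ ∀ x₁ x₂ x₃ x₄, (x₁, x₂, x₃, x₄) ∈ R → s x₁ = s x₄ ∧ s x₃ = s x₂)
    (htwo : ∀ v : ι → ZMod 2,
      (∀ x₁ x₂ x₃ x₄, (x₁, x₂, x₃, x₄) ∈ R → v x₁ + v x₃ = v x₂ + v x₄) →
      ∀ x₁ x₂ x₃ x₄, (x₁, x₂, x₃, x₄) ∈ R → v x₁ = v x₄ ∧ v x₃ = v x₂) :
    p ≤ 2 ^ (Fintype.card ι - 1) := by
  classical
  let A : Matrix R ι ℤ := Matrix.of fun q =>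
    differenceRow (q.1.1, q.1.2.1) + differenceRow (q.1.2.2.1, q.1.2.2.2)
  let d : R × Bool → ι × ι := fun q =>
    if q.2 then (q.1.1.1, q.1.1.2.2.2) else (q.1.1.2.2.1, q.1.1.2.1)
  let B : Matrix (R × Bool) ι ℤ := Matrix.of fun q => differenceRow (d q)
  have mulVec_row : ∀ (F : Type) [Field F] (a b : ι) (v : ι → F),
      ∑ j, ((differenceRow (a, b) j : ℤ) : F) * v j = v a - v b := by
    intro F _ a b v
    simp [differenceRow, sub_mul, Finset.sum_sub_distrib, Pi.single_apply]
  have hA : ∀ (F : Type) [Field F] (v : ι → F), (A.map (Int.cast : ℤ → F)).mulVec v = 0 ↔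
      ∀ x₁ x₂ x₃ x₄, (x₁, x₂, x₃, x₄) ∈ R → v x₁ + v x₃ = v x₂ + v x₄ := by
    intro F _ v
    have key : ∀ q : R, (A.map (Int.cast : ℤ → F)).mulVec v q
        = (v q.1.1 - v q.1.2.1) + (v q.1.2.2.1 - v q.1.2.2.2) := by
      intro q
      rw [← mulVec_row, ← mulVec_row, ← Finset.sum_add_distrib]
      simp [Matrix.mulVec, dotProduct, A, add_mul]
    constructor
    · intro h x₁ x₂ x₃ x₄ hq
      have := congrFun h ⟨_, hq⟩
      rw [key] at this
      simp only [Pi.zero_apply] at this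
      linear_combination this
    · intro h
      ext ⟨⟨x₁, x₂, x₃, x₄⟩, hq⟩
      rw [key]
      simp only [Pi.zero_apply]
      linear_combination h x₁ x₂ x₃ x₄ hq
  have hB : ∀ (F : Type) [Field F] (v : ι → F), (B.map (Int.cast : ℤ → F)).mulVec v = 0 ↔
      ∀ x₁ x₂ x₃ x₄, (x₁, x₂, x₃, x₄) ∈ R → v x₁ = v x₄ ∧ v x₃ = v x₂ := by
    intro F _ v
    have key : ∀ q : R × Bool, (B.map (Int.cast : ℤ → F)).mulVec v q
        = v (d q).1 - v (d q).2 := by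
      intro q
      rw [← mulVec_row]
      simp [Matrix.mulVec, dotProduct, B]
    constructor
    · intro h x₁ x₂ x₃ x₄ hq
      have h1 := congrFun h (⟨_, hq⟩, true)
      have h2 := congrFun h (⟨_, hq⟩, false)
      rw [key] at h1 h2
      simp only [Pi.zero_apply, d, if_true, sub_eq_zero] at h1 h2
      exact ⟨h1, by simpa using h2⟩
    · intro h
      ext ⟨⟨⟨x₁, x₂, x₃, x₄⟩, hq⟩, b⟩
      rw [key]
      cases b <;> simp [d, h x₁ x₂ x₃ x₄ hq]
  have det_cast : ∀ (F : Type) [Field F] {κ : Type u} (M : Matrix κ ι ℤ) {k : ℕ} (f : Fin k → κ)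
      (g : Fin k → ι), ((M.map (Int.cast : ℤ → F)).submatrix f g).det
        = (((M.submatrix f g).det : ℤ) : F) := by
    intro F _ κ M k f g
    exact ((Int.castRingHom F).map_det (M.submatrix f g)).symm
  set A2 := A.map (Int.cast : ℤ → ZMod 2) with hA2
  set B2 := B.map (Int.cast : ℤ → ZMod 2) with hB2
  set Ap := A.map (Int.cast : ℤ → ZMod p) with hAp
  set Bp := B.map (Int.cast : ℤ → ZMod p) with hBp
  -- A minor of `B` is 0 or ±1, so one that is nonzero modulo `p` is ±1 and stays nonzero modulo 2.
  have h1 : Bp.rank ≤ B2.rank := by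
    obtain ⟨f, g, hfg⟩ := Bp.exists_det_submatrix_ne_zero
    refine B2.le_rank_of_det_submatrix_ne_zero f g ?_
    replace hfg := (det_cast (ZMod p) B f g).symm.trans_ne hfg
    refine (det_cast (ZMod 2) B f g).trans_ne ?_
    obtain ⟨ε, hε⟩ := (Matrix.isTotallyUnimodular_iff _).1
      (isTotallyUnimodular_differenceRow (ι := ι)) _ (d ∘ f) g
    change (ε : ℤ) = (B.submatrix f g).det at hε
    rw [← hε] at hfg ⊢
    clear hε
    cases ε
    · exact absurd (by simp) hfg
    · rw [SignType.neg_eq_neg_one]; simp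
    · rw [SignType.pos_eq_one]; simp
  have h2 : B2.rank ≤ A2.rank :=
    A2.rank_le_rank_of_ker_le B2 fun v hv => (hB _ v).2 (htwo v ((hA _ v).1 hv))
  -- Trivial solutions always satisfy the relations, and `s` is a further solution of `A` modulo
  -- `p`.
  have h3 : Ap.rank < Bp.rank := by
    refine Ap.rank_lt_rank_of_ker_lt Bp (fun v hv => (hA _ v).2 ?_) s ((hA _ s).2 hs)
      (fun h => hs' ((hB _ s).1 h))
    intro x₁ x₂ x₃ x₄ hq
    obtain ⟨e1, e2⟩ := (hB _ v).1 hv x₁ x₂ x₃ x₄ hq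
    rw [e1, e2, add_comm]
  -- Constant vectors lie in the kernel, which costs one rank.
  have h4 : A2.rank ≤ Fintype.card ι - 1 := by
    have hone : A2.mulVec 1 = 0 := (hA _ 1).2 (by simp)
    have hr := LinearMap.finrank_range_add_finrank_ker A2.mulVecLin
    have hι : Nonempty ι := by
      by_contra hne
      exact hs' fun x₁ => (hne ⟨x₁⟩).elim
    have hk : 0 < Module.finrank (ZMod 2) A2.mulVecLin.ker := by
      rw [Module.finrank_pos_iff]
      refine ⟨⟨1, hone⟩, 0, fun h => ?_⟩
      have := congrFun (congrArg Subtype.val h) hι.some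
      simp at this
    rw [Module.finrank_fintype_fun_eq_card] at hr
    rw [Matrix.rank]
    omega
  obtain ⟨f, g, hfg⟩ := A2.exists_det_submatrix_ne_zero
  -- The size of this minor is the rank of `A` modulo 2, which exceeds its rank modulo `p`.
  have hp : (((A.submatrix f g).det : ℤ) : ZMod p) = 0 := by
    by_contra hne
    replace hne := (det_cast (ZMod p) A f g).trans_ne hne
    have := Ap.le_rank_of_det_submatrix_ne_zero f g hne
    omega
  replace hfg := (det_cast (ZMod 2) A f g).symm.trans_ne hfg
  have hdet : (A.submatrix f g).det ≠ 0 := fun h => hfg (by rw [h]; simp)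
  have hdvd := (ZMod.intCast_zmod_eq_zero_iff_dvd _ p).1 hp
  have hle := Int.le_of_dvd (abs_pos.2 hdet) ((dvd_abs _ _).2 hdvd)
  have hbound : |(A.submatrix f g).det| ≤ 2 ^ A2.rank := abs_det_le_two_pow _ _ f g
  have : (p : ℤ) ≤ 2 ^ (Fintype.card ι - 1) :=
    hle.trans (hbound.trans (pow_le_pow_right₀ (by norm_num) h4))
  exact_mod_cast this

open Filter Topology

/-! ### Plane geometry -/

/-- The determinant of two plane vectors. -/
def planeDet (u w : ℝ × ℝ) : ℝ := u.1 * w.2 - u.2 * w.1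

theorem planeDet_ne_zero_iff {u w : ℝ × ℝ} :
    planeDet u w ≠ 0 ↔ LinearIndependent ℝ ![u, w] := by
  rw [LinearIndependent.pair_iff]
  constructor
  · intro h s t hst
    have h1 := congrArg Prod.fst hst
    have h2 := congrArg Prod.snd hst
    simp only [Prod.fst_add, Prod.snd_add, Prod.smul_fst, Prod.smul_snd, smul_eq_mul,
      Prod.fst_zero, Prod.snd_zero] at h1 h2
    constructor
    · refine (mul_eq_zero.1 (?_ : s * planeDet u w = 0)).resolve_right h
      rw [planeDet]; linear_combination w.2 * h1 - w.1 * h2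
    · refine (mul_eq_zero.1 (?_ : t * planeDet u w = 0)).resolve_right h
      rw [planeDet]; linear_combination u.1 * h2 - u.2 * h1
  · intro h h0
    rw [planeDet] at h0
    have h1 := h w.2 (-u.2) (by ext <;> simp <;> linarith)
    have h2 := h w.1 (-u.1) (by ext <;> simp <;> linarith)
    have := h 1 0 (by ext <;> simp <;> linarith [h1.2, h2.2])
    exact one_ne_zero this.1

theorem planeDet_swap (u w : ℝ × ℝ) : planeDet w u = -planeDet u w := by
  simp only [planeDet]; ring

/-- Coordinates with respect to a basis are unique. -/
theorem coords_eq_zero {u w : ℝ × ℝ} (h : planeDet u w ≠ 0) {a b : ℝ}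
    (hab : a • u + b • w = 0) : a = 0 ∧ b = 0 :=
  LinearIndependent.pair_iff.1 (planeDet_ne_zero_iff.1 h) a b hab

/-- A transverse vector in coordinates with respect to a basis. -/
theorem exists_coords {u w w' : ℝ × ℝ} (h : planeDet u w ≠ 0) (h' : planeDet u w' ≠ 0) :
    ∃ a b : ℝ, b ≠ 0 ∧ w' = a • u + b • w := by
  refine ⟨planeDet w' w / planeDet u w, planeDet u w' / planeDet u w, div_ne_zero h' h, ?_⟩
  ext
  · simp only [Prod.fst_add, Prod.smul_fst, smul_eq_mul]
    field_simp
    simp only [planeDet]; ring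
  · simp only [Prod.snd_add, Prod.smul_snd, smul_eq_mul]
    field_simp
    simp only [planeDet]; ring

/-- Vectors with vanishing determinant are parallel. -/
theorem exists_smul_of_planeDet_eq_zero {u w : ℝ × ℝ} (hu : u ≠ 0) (h : planeDet u w = 0) :
    ∃ l : ℝ, w = l • u := by
  rw [planeDet] at h
  by_cases h1 : u.1 = 0
  · have h2 : u.2 ≠ 0 := fun h2 => hu (Prod.ext h1 h2)
    refine ⟨w.2 / u.2, Prod.ext ?_ ?_⟩
    · simp only [Prod.smul_fst, smul_eq_mul, h1, mul_zero]
      refine (mul_eq_zero.1 (?_ : u.2 * w.1 = 0)).resolve_left h2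
      rw [h1] at h; linarith
    · simp only [Prod.smul_snd, smul_eq_mul]; field_simp
  · refine ⟨w.1 / u.1, Prod.ext ?_ ?_⟩
    · simp only [Prod.smul_fst, smul_eq_mul]; field_simp
    · simp only [Prod.smul_snd, smul_eq_mul]; field_simp; linarith

/-- A neighbourhood of the origin of the plane contains a square. -/
theorem exists_square_of_eventually {P : ℝ × ℝ → Prop} (h : ∀ᶠ q in 𝓝 (0 : ℝ × ℝ), P q) :
    ∃ ε > 0, ∀ a b : ℝ, |a| < ε → |b| < ε → P (a, b) := by
  obtain ⟨ε, hε, H⟩ := Metric.eventually_nhds_iff.1 h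
  refine ⟨ε, hε, fun a b ha hb => H ?_⟩
  rw [Prod.dist_eq]
  simpa using And.intro ha hb

theorem PolygonalKnot.point_fst (P : PolygonalKnot) (i : ZMod P.n) (s : ℝ) :
    (P.point i s).1 = (P.vertex i).1 + s • P.dir i := by
  simp only [point, dir, AffineMap.lineMap_apply, vsub_eq_sub, vadd_eq_add, Prod.fst_add,
    Prod.smul_fst, Prod.fst_sub]
  exact add_comm _ _

namespace KnotDiagram

variable (D : KnotDiagram)

instance : NeZero D.n := ⟨by have := D.three_le; omega⟩

/-- The projection of the point with parameter `s` on edge `i`. -/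
def planePoint (i : ZMod D.n) (s : ℝ) : ℝ × ℝ := (D.vertex i).1 + s • D.dir i

variable {D}

theorem point_fst (i : ZMod D.n) (s : ℝ) : (D.point i s).1 = D.planePoint i s :=
  D.toPolygonalKnot.point_fst i s

theorem continuous_planePoint (i : ZMod D.n) : Continuous (D.planePoint i) := by
  unfold planePoint; fun_prop

theorem planePoint_add (i : ZMod D.n) (s r : ℝ) :
    D.planePoint i (s + r) = D.planePoint i s + r • D.dir i := by
  simp only [planePoint, add_smul, add_assoc]

theorem planePoint_one (i : ZMod D.n) : D.planePoint i 1 = D.planePoint (i + 1) 0 := by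
  simp [planePoint, PolygonalKnot.dir]

theorem mem_shadow {x : ℝ × ℝ} :
    x ∈ D.shadow ↔ ∃ i s, s ∈ Set.Ico (0 : ℝ) 1 ∧ D.planePoint i s = x := by
  constructor
  · rintro ⟨_, ⟨i, s, hs, rfl⟩, rfl⟩
    exact ⟨i, s, hs, (point_fst i s).symm⟩
  · rintro ⟨i, s, hs, rfl⟩
    exact ⟨_, ⟨i, s, hs, rfl⟩, point_fst i s⟩

theorem transverse_planePoint {i j : ZMod D.n} {s t : ℝ} (hs : s ∈ Set.Ico (0 : ℝ) 1)
    (ht : t ∈ Set.Ico (0 : ℝ) 1) (h : D.planePoint i s = D.planePoint j t)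
    (hne : (i, s) ≠ (j, t)) : s ≠ 0 ∧ t ≠ 0 ∧ planeDet (D.dir i) (D.dir j) ≠ 0 := by
  rw [← point_fst, ← point_fst] at h
  rw [planeDet_ne_zero_iff]
  exact D.transverse i j s t hs ht h hne

theorem dir_ne_zero (i : ZMod D.n) : D.dir i ≠ 0 := by
  intro h
  exact (transverse_planePoint (D := D) (i := i) (j := i) (s := 0) (t := 1 / 2) (by norm_num)
    (by norm_num) (by simp [planePoint, h]) (by simp)).1 rfl

/-- The closed edges that pass through a vertex. -/
theorem edge_through_vertex {i k : ZMod D.n} {u : ℝ} (hu : u ∈ Set.Icc (0 : ℝ) 1)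
    (h : D.planePoint k u = D.planePoint i 0) : (k = i ∧ u = 0) ∨ (k + 1 = i ∧ u = 1) := by
  rcases hu.2.lt_or_eq with h1 | rfl
  · left
    by_contra hne
    exact (transverse_planePoint ⟨hu.1, h1⟩ (by norm_num) h
      (fun e => hne (by simpa using e))).2.1 rfl
  · right
    refine ⟨?_, rfl⟩
    rw [planePoint_one] at h
    by_contra hne
    exact (transverse_planePoint (by norm_num) (by norm_num) h (fun e => hne (by simpa using e))).1
      rfl

/-- The closed edges that pass through an interior point of an edge pass through it in their
interiors. -/
theorem edge_through_interior {i k : ZMod D.n} {s u : ℝ} (hs : s ∈ Set.Ioo (0 : ℝ) 1)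
    (hu : u ∈ Set.Icc (0 : ℝ) 1) (h : D.planePoint k u = D.planePoint i s) :
    u ∈ Set.Ico (0 : ℝ) 1 := by
  refine ⟨hu.1, lt_of_le_of_ne hu.2 ?_⟩
  rintro rfl
  rw [planePoint_one] at h
  by_cases he : (k + 1, (0 : ℝ)) = (i, s)
  · exact hs.1.ne (congrArg Prod.snd he)
  · exact (transverse_planePoint (by norm_num) ⟨hs.1.le, hs.2⟩ h he).1 rfl

/-- Near a point, the shadow consists of the closed edges through that point. -/
theorem eventually_edge_through (c : ℝ × ℝ) : ∀ᶠ x in 𝓝 c, x ∈ D.shadow →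
    ∃ k, ∃ u ∈ Set.Icc (0 : ℝ) 1, ∃ u' ∈ Set.Icc (0 : ℝ) 1,
      D.planePoint k u = c ∧ D.planePoint k u' = x := by
  have hk : ∀ k : ZMod D.n, ∀ᶠ x in 𝓝 c, x ∈ D.planePoint k '' Set.Icc 0 1 →
      c ∈ D.planePoint k '' Set.Icc 0 1 := by
    intro k
    by_cases hc : c ∈ D.planePoint k '' Set.Icc 0 1
    · exact Eventually.of_forall fun _ _ => hc
    · have hcl : IsClosed (D.planePoint k '' Set.Icc 0 1) :=
        (isCompact_Icc.image (continuous_planePoint k)).isClosed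
      filter_upwards [hcl.isOpen_compl.mem_nhds hc] with x hx hx'
      exact absurd hx' hx
  filter_upwards [eventually_all.2 hk] with x hx hxs
  obtain ⟨k, u', hu', rfl⟩ := mem_shadow.1 hxs
  obtain ⟨u, hu, hc⟩ := hx k ⟨u', ⟨hu'.1, hu'.2.le⟩, rfl⟩
  exact ⟨k, u, hu, u', ⟨hu'.1, hu'.2.le⟩, hc, rfl⟩

/-! ### Regions near a point -/

variable (D) in
/-- The point `x` lies in the region `R`. -/
def InRegion (x : ℝ × ℝ) (R : D.Region) : Prop := ∃ h : x ∉ D.shadow, D.regionOf x h = R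

theorem InRegion.unique {x : ℝ × ℝ} {R S : D.Region} (hR : D.InRegion x R)
    (hS : D.InRegion x S) : R = S := by
  obtain ⟨_, rfl⟩ := hR
  obtain ⟨_, rfl⟩ := hS
  rfl

/-- A connected set in the complement of the shadow lies in one region. -/
theorem exists_inRegion {Q : Set (ℝ × ℝ)} (hQ : IsPreconnected Q) (hne : Q.Nonempty)
    {φ : ℝ × ℝ → ℝ × ℝ} (hφ : Continuous φ) (h : ∀ q ∈ Q, φ q ∉ D.shadow) :
    ∃ R, ∀ q ∈ Q, D.InRegion (φ q) R := by
  obtain ⟨q₀, hq₀⟩ := hne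
  refine ⟨D.regionOf _ (h q₀ hq₀), fun q hq => ⟨h q hq, ?_⟩⟩
  let ψ : Q → {x : ℝ × ℝ // x ∉ D.shadow} := fun q => ⟨φ q, h q q.2⟩
  have hψ : Continuous ψ := (hφ.comp continuous_subtype_val).subtype_mk _
  have : PreconnectedSpace Q := isPreconnected_iff_preconnectedSpace.1 hQ
  exact ConnectedComponents.coe_eq_coe'.2
    ((isPreconnected_range hψ).subset_connectedComponent ⟨⟨q₀, hq₀⟩, rfl⟩ ⟨⟨q, hq⟩, rfl⟩)

variable (D) in
/-- Near `c`, the two sides of the line through `c` with direction `u` lie in `R` and `R'`. -/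
def LineModel (c u w : ℝ × ℝ) (R R' : D.Region) : Prop :=
  ∃ ε > 0, ∀ a b : ℝ, |a| < ε → |b| < ε →
    (0 < b → D.InRegion (c + a • u + b • w) R) ∧ (b < 0 → D.InRegion (c + a • u + b • w) R')

variable (D) in
/-- Near `c`, the four quadrants with respect to the directions `u` and `w` lie in the regions
`R₁, R₂, R₃, R₄`. -/
def CrossModel (c u w : ℝ × ℝ) (R₁ R₂ R₃ R₄ : D.Region) : Prop :=
  ∃ ε > 0, ∀ a b : ℝ, |a| < ε → |b| < ε →
    (0 < a → 0 < b → D.InRegion (c + a • u + b • w) R₁) ∧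
    (a < 0 → 0 < b → D.InRegion (c + a • u + b • w) R₂) ∧
    (0 < a → b < 0 → D.InRegion (c + a • u + b • w) R₃) ∧
    (a < 0 → b < 0 → D.InRegion (c + a • u + b • w) R₄)

variable (D) in
/-- Near `c`, the sector spanned by `u` and `w` lies in `R` and the opposite one in `R'`. -/
def CornerModel (c u w : ℝ × ℝ) (R R' : D.Region) : Prop :=
  ∃ ε > 0, ∀ a b : ℝ, |a| < ε → |b| < ε →
    (0 < a → 0 < b → D.InRegion (c + a • u + b • w) R) ∧
    (a < 0 ∨ b < 0 → D.InRegion (c + a • u + b • w) R')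

/-- Turns the local description of the shadow into a statement on coordinates: the displacement of a
nearby shadow point from `c` is a multiple of the direction of some edge through `c`. Each local
model below follows by listing the edges through `c`. -/
theorem exists_square_edge_through (c u w : ℝ × ℝ) : ∃ ε > 0, ∀ a b : ℝ, |a| < ε → |b| < ε →
    c + a • u + b • w ∈ D.shadow → ∃ k, ∃ t ∈ Set.Icc (0 : ℝ) 1, ∃ t' ∈ Set.Icc (0 : ℝ) 1,
      D.planePoint k t = c ∧ (t' - t) • D.dir k = a • u + b • w := by
  have hc : Tendsto (fun q : ℝ × ℝ => c + q.1 • u + q.2 • w) (𝓝 0) (𝓝 c) :=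
    (by fun_prop : Continuous fun q : ℝ × ℝ => c + q.1 • u + q.2 • w).tendsto' _ _ (by simp)
  obtain ⟨ε, hε, H⟩ := exists_square_of_eventually (hc.eventually (eventually_edge_through (D := D) c))
  refine ⟨ε, hε, fun a b ha hb hab => ?_⟩
  obtain ⟨k, t, ht, t', ht', e, e'⟩ := H a b ha hb hab
  refine ⟨k, t, ht, t', ht', e, ?_⟩
  have := planePoint_add (D := D) k t (t' - t)
  rw [add_sub_cancel, e, e'] at this
  simpa [add_assoc] using this.symm

theorem isPreconnected_rectangle (a b a' b' : ℝ) :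
    IsPreconnected (Set.Ioo a b ×ˢ Set.Ioo a' b') :=
  isPreconnected_Ioo.prod isPreconnected_Ioo

theorem exists_lineModel {c u w : ℝ × ℝ} {ε : ℝ} (hε : 0 < ε)
    (H : ∀ a b : ℝ, |a| < ε → |b| < ε → c + a • u + b • w ∈ D.shadow → b = 0) :
    ∃ R R', D.LineModel c u w R R' := by
  have hφ : Continuous fun q : ℝ × ℝ => c + q.1 • u + q.2 • w := by fun_prop
  obtain ⟨R, hR⟩ := exists_inRegion (D := D) (isPreconnected_rectangle (-ε) ε 0 ε)
    ⟨(0, ε / 2), by simp [hε]⟩ hφ (by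
      rintro ⟨a, b⟩ ⟨ha, hb⟩ h
      exact hb.1.ne' (H a b (abs_lt.2 ha) (abs_lt.2 ⟨by linarith [hb.1], hb.2⟩) h))
  obtain ⟨R', hR'⟩ := exists_inRegion (D := D) (isPreconnected_rectangle (-ε) ε (-ε) 0)
    ⟨(0, -(ε / 2)), by simp [hε]⟩ hφ (by
      rintro ⟨a, b⟩ ⟨ha, hb⟩ h
      exact hb.2.ne (H a b (abs_lt.2 ha) (abs_lt.2 ⟨hb.1, by linarith [hb.2]⟩) h))
  exact ⟨R, R', ε, hε, fun a b ha hb =>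
    ⟨fun h => hR (a, b) ⟨abs_lt.1 ha, h, (abs_lt.1 hb).2⟩,
      fun h => hR' (a, b) ⟨abs_lt.1 ha, (abs_lt.1 hb).1, h⟩⟩⟩

theorem exists_crossModel_of_square {c u w : ℝ × ℝ} {ε : ℝ} (hε : 0 < ε)
    (H : ∀ a b : ℝ, |a| < ε → |b| < ε → c + a • u + b • w ∈ D.shadow → a = 0 ∨ b = 0) :
    ∃ R₁ R₂ R₃ R₄, D.CrossModel c u w R₁ R₂ R₃ R₄ := by
  have hφ : Continuous fun q : ℝ × ℝ => c + q.1 • u + q.2 • w := by fun_prop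
  have key : ∀ l r l' r' : ℝ, l < r → l' < r' → -ε ≤ l → r ≤ ε → -ε ≤ l' → r' ≤ ε →
      (0 ≤ l ∨ r ≤ 0) → (0 ≤ l' ∨ r' ≤ 0) →
      ∃ R, ∀ q ∈ Set.Ioo l r ×ˢ Set.Ioo l' r', D.InRegion (c + q.1 • u + q.2 • w) R := by
    intro l r l' r' h1 h2 h3 h4 h5 h6 h7 h8
    refine exists_inRegion (isPreconnected_rectangle l r l' r')
      ⟨((l + r) / 2, (l' + r') / 2), ⟨by constructor <;> dsimp only <;> linarith,
        by constructor <;> dsimp only <;> linarith⟩⟩ hφ ?_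
    rintro ⟨a, b⟩ ⟨⟨ha, ha'⟩, hb, hb'⟩ h
    dsimp only at ha ha' hb hb'
    rcases H a b (abs_lt.2 ⟨by linarith, by linarith⟩) (abs_lt.2 ⟨by linarith, by linarith⟩) h
      with h0 | h0
    · rcases h7 with h7 | h7 <;> linarith
    · rcases h8 with h8 | h8 <;> linarith
  obtain ⟨R₁, h₁⟩ := key 0 ε 0 ε hε hε (by linarith) le_rfl (by linarith) le_rfl
    (Or.inl le_rfl) (Or.inl le_rfl)
  obtain ⟨R₂, h₂⟩ := key (-ε) 0 0 ε (by linarith) hε le_rfl hε.le (by linarith) le_rfl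
    (Or.inr le_rfl) (Or.inl le_rfl)
  obtain ⟨R₃, h₃⟩ := key 0 ε (-ε) 0 hε (by linarith) (by linarith) le_rfl le_rfl hε.le
    (Or.inl le_rfl) (Or.inr le_rfl)
  obtain ⟨R₄, h₄⟩ := key (-ε) 0 (-ε) 0 (by linarith) (by linarith) le_rfl hε.le le_rfl hε.le
    (Or.inr le_rfl) (Or.inr le_rfl)
  refine ⟨R₁, R₂, R₃, R₄, ε, hε, fun a b ha hb => ?_⟩
  rw [abs_lt] at ha hb
  exact ⟨fun h h' => h₁ (a, b) ⟨⟨h, ha.2⟩, h', hb.2⟩, fun h h' => h₂ (a, b) ⟨⟨ha.1, h⟩, h', hb.2⟩,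
    fun h h' => h₃ (a, b) ⟨⟨h, ha.2⟩, hb.1, h'⟩, fun h h' => h₄ (a, b) ⟨⟨ha.1, h⟩, hb.1, h'⟩⟩

/-- The complement of the open sector is not convex. It is covered by two overlapping rectangles,
whose union is connected and therefore lies in a single region. -/
theorem exists_cornerModel {c u w : ℝ × ℝ} {ε : ℝ} (hε : 0 < ε)
    (H : ∀ a b : ℝ, |a| < ε → |b| < ε → c + a • u + b • w ∈ D.shadow →
      (a = 0 ∧ 0 ≤ b) ∨ (b = 0 ∧ 0 ≤ a)) :
    ∃ R R', D.CornerModel c u w R R' := by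
  have hφ : Continuous fun q : ℝ × ℝ => c + q.1 • u + q.2 • w := by fun_prop
  obtain ⟨R, hR⟩ := exists_inRegion (D := D) (isPreconnected_rectangle 0 ε 0 ε)
    ⟨(ε / 2, ε / 2), by simp [hε]⟩ hφ (by
      rintro ⟨a, b⟩ ⟨⟨ha, ha'⟩, hb, hb'⟩ h
      dsimp only at ha ha' hb hb'
      rcases H a b (abs_lt.2 ⟨by linarith, by linarith⟩) (abs_lt.2 ⟨by linarith, by linarith⟩) h
        with h0 | h0 <;> linarith [h0.1])
  obtain ⟨R', hR'⟩ := exists_inRegion (D := D)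
    (IsPreconnected.union (-(ε / 2), -(ε / 2)) (by simp [hε]; linarith) (by simp [hε]; linarith)
      (isPreconnected_rectangle (-ε) 0 (-ε) ε) (isPreconnected_rectangle (-ε) ε (-ε) 0))
    ⟨(-(ε / 2), -(ε / 2)), by simp [hε]; linarith⟩ hφ (by
      rintro ⟨a, b⟩ hab h
      rcases hab with ⟨⟨ha, ha'⟩, hb, hb'⟩ | ⟨⟨ha, ha'⟩, hb, hb'⟩ <;>
      · dsimp only at ha ha' hb hb'
        rcases H a b (abs_lt.2 ⟨by linarith, by linarith⟩) (abs_lt.2 ⟨by linarith, by linarith⟩) h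
          with h0 | h0 <;> linarith [h0.1, h0.2])
  refine ⟨R, R', ε, hε, fun a b ha hb => ?_⟩
  rw [abs_lt] at ha hb
  refine ⟨fun h h' => hR (a, b) ⟨⟨h, ha.2⟩, h', hb.2⟩, fun h => hR' (a, b) ?_⟩
  rcases h with h | h
  · exact Or.inl ⟨⟨ha.1, h⟩, hb⟩
  · exact Or.inr ⟨ha, hb.1, h⟩

theorem LineModel.smul {c u w : ℝ × ℝ} {R R' : D.Region} (h : D.LineModel c u w R R') {l : ℝ}
    (hl : l ≠ 0) : D.LineModel c (l • u) w R R' := by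
  obtain ⟨ε, hε, H⟩ := h
  have hl' : 0 < |l| := abs_pos.2 hl
  refine ⟨min ε (ε / |l|), by positivity, fun a b ha hb => ?_⟩
  have := H (a * l) b (by
    rw [abs_mul]; exact (lt_div_iff₀ hl').1 (ha.trans_le (min_le_right _ _)))
    (hb.trans_le (min_le_left _ _))
  simpa only [smul_smul] using this

theorem LineModel.shift {c u w : ℝ × ℝ} {R R' : D.Region} (h : D.LineModel c u w R R') :
    ∀ᶠ r in 𝓝 (0 : ℝ), D.LineModel (c + r • u) u w R R' := by
  obtain ⟨ε, hε, H⟩ := h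
  filter_upwards [Metric.ball_mem_nhds (0 : ℝ) hε] with r hr
  rw [mem_ball_zero_iff, Real.norm_eq_abs] at hr
  refine ⟨ε - |r|, by linarith, fun a b ha hb => ?_⟩
  have := H (r + a) b (by linarith [abs_add_le r a]) (by linarith [abs_nonneg r])
  simpa only [add_smul, add_assoc] using this

theorem CrossModel.swap {c u w : ℝ × ℝ} {R₁ R₂ R₃ R₄ : D.Region}
    (h : D.CrossModel c u w R₁ R₂ R₃ R₄) : D.CrossModel c w u R₁ R₃ R₂ R₄ := by
  obtain ⟨ε, hε, H⟩ := h
  refine ⟨ε, hε, fun a b ha hb => ?_⟩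
  obtain ⟨h1, h2, h3, h4⟩ := H b a hb ha
  rw [add_right_comm] at h1 h2 h3 h4
  exact ⟨fun x y => h1 y x, fun x y => h3 y x, fun x y => h2 y x, fun x y => h4 y x⟩

theorem CornerModel.swap {c u w : ℝ × ℝ} {R R' : D.Region}
    (h : D.CornerModel c u w R R') : D.CornerModel c w u R R' := by
  obtain ⟨ε, hε, H⟩ := h
  refine ⟨ε, hε, fun a b ha hb => ?_⟩
  obtain ⟨h1, h2⟩ := H b a hb ha
  rw [add_right_comm] at h1 h2
  exact ⟨fun x y => h1 y x, fun x => h2 x.symm⟩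

/-- A small step from the center along `u` leaves only the `u`-line in view. Ahead its sides are
`R₁` and `R₃`, behind they are `R₂` and `R₄`. -/
theorem CrossModel.lineModel {c u w : ℝ × ℝ} {R₁ R₂ R₃ R₄ : D.Region}
    (h : D.CrossModel c u w R₁ R₂ R₃ R₄) :
    (∀ᶠ r in 𝓝[>] (0 : ℝ), D.LineModel (c + r • u) u w R₁ R₃) ∧
      ∀ᶠ r in 𝓝[<] (0 : ℝ), D.LineModel (c + r • u) u w R₂ R₄ := by
  obtain ⟨ε, hε, H⟩ := h
  constructor
  · filter_upwards [Ioo_mem_nhdsGT hε] with r hr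
    refine ⟨min r (ε - r), lt_min hr.1 (by linarith [hr.2]), fun a b ha hb => ?_⟩
    rw [lt_min_iff] at ha hb
    rw [abs_lt, abs_lt] at ha
    obtain ⟨h1, h2, h3, h4⟩ := H (r + a) b (abs_lt.2 ⟨by linarith [ha.1.1], by linarith [ha.2.2]⟩)
      (by linarith [hb.2, hr.1])
    simp only [add_smul, ← add_assoc] at h1 h3
    exact ⟨h1 (by linarith [ha.1.1]), h3 (by linarith [ha.1.1])⟩
  · filter_upwards [Ioo_mem_nhdsLT (neg_lt_zero.2 hε)] with r hr
    refine ⟨min (-r) (ε + r), lt_min (by linarith [hr.2]) (by linarith [hr.1]),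
      fun a b ha hb => ?_⟩
    rw [lt_min_iff] at ha hb
    rw [abs_lt, abs_lt] at ha
    obtain ⟨h1, h2, h3, h4⟩ := H (r + a) b (abs_lt.2 ⟨by linarith [ha.2.1], by linarith [ha.1.2]⟩)
      (by linarith [hb.2, hr.2])
    simp only [add_smul, ← add_assoc] at h2 h4
    exact ⟨h2 (by linarith [ha.1.2]), h4 (by linarith [ha.1.2])⟩

theorem CornerModel.lineModel {c u w : ℝ × ℝ} {R R' : D.Region}
    (h : D.CornerModel c u w R R') :
    ∀ᶠ r in 𝓝[>] (0 : ℝ), D.LineModel (c + r • u) u w R R' := by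
  obtain ⟨ε, hε, H⟩ := h
  filter_upwards [Ioo_mem_nhdsGT hε] with r hr
  refine ⟨min r (ε - r), lt_min hr.1 (by linarith [hr.2]), fun a b ha hb => ?_⟩
  rw [lt_min_iff] at ha hb
  rw [abs_lt, abs_lt] at ha
  obtain ⟨h1, h2⟩ := H (r + a) b (abs_lt.2 ⟨by linarith [ha.1.1], by linarith [ha.2.2]⟩)
    (by linarith [hb.2, hr.1])
  simp only [add_smul, ← add_assoc] at h1 h2
  exact ⟨h1 (by linarith [ha.1.1]), fun hb' => h2 (Or.inr hb')⟩

/-- Near a crossing the complement of the shadow has four quadrants. -/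
theorem exists_crossModel {i j : ZMod D.n} {s t : ℝ} (hs : s ∈ Set.Ico (0 : ℝ) 1)
    (ht : t ∈ Set.Ico (0 : ℝ) 1) (h : D.planePoint i s = D.planePoint j t)
    (hne : (i, s) ≠ (j, t)) :
    ∃ R₁ R₂ R₃ R₄, D.CrossModel (D.planePoint i s) (D.dir i) (D.dir j) R₁ R₂ R₃ R₄ := by
  obtain ⟨hs0, ht0, hdet⟩ := transverse_planePoint hs ht h hne
  obtain ⟨ε, hε, H⟩ := exists_square_edge_through (D := D) (D.planePoint i s) (D.dir i) (D.dir j)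
  refine exists_crossModel_of_square hε fun a b ha hb hab => ?_
  obtain ⟨k, u, hu, u', -, e, e'⟩ := H a b ha hb hab
  have hu' := edge_through_interior ⟨lt_of_le_of_ne hs.1 hs0.symm, hs.2⟩ hu e
  -- Without triple points, an edge through the crossing is one of the two strands, so every nearby
  -- shadow point lies on a coordinate axis.
  have hk := D.no_triple k i j u s t hu' hs ht (by rw [point_fst, point_fst, e])
    (by rw [point_fst, point_fst, h])
  rcases hk with hk | hk | hk
  · obtain ⟨rfl, -⟩ := Prod.mk.inj hk
    exact Or.inr (coords_eq_zero hdet (a := a - (u' - u)) (b := b)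
      (by rw [sub_smul, e']; abel)).2
  · exact absurd hk hne
  · obtain ⟨rfl, -⟩ := Prod.mk.inj hk
    exact Or.inl (coords_eq_zero hdet (a := a) (b := b - (u' - u))
      (by rw [sub_smul, e']; abel)).1

/-! ### Sums of colors across a strand, and Dehn 2-colorings -/

variable (D) in
/-- The sum of the colors on the two sides of edge `i` at the parameter `s` is `δ`. -/
def SideSum (C : D.Region → ZMod 2) (i : ZMod D.n) (s : ℝ) (δ : ZMod 2) : Prop :=
  ∃ w R R', planeDet (D.dir i) w ≠ 0 ∧ D.LineModel (D.planePoint i s) (D.dir i) w R R' ∧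
    C R + C R' = δ

/-- Another transversal has the form `a • u + b • w` with `b ≠ 0`. It keeps or exchanges the two
sides according to the sign of `b`, and the sum is symmetric. The points at small positive and
negative multiples of the new transversal identify the regions. -/
theorem SideSum.unique {C : D.Region → ZMod 2} {i : ZMod D.n} {s : ℝ} {δ δ' : ZMod 2}
    (h : D.SideSum C i s δ) (h' : D.SideSum C i s δ') : δ = δ' := by
  obtain ⟨w, R, R', hw, ⟨ε, hε, H⟩, rfl⟩ := h
  obtain ⟨w', S, S', hw', ⟨ε', hε', H'⟩, rfl⟩ := h'
  obtain ⟨a, b, hb, rfl⟩ := exists_coords hw hw'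
  have e1 : ∀ᶠ r in 𝓝[>] (0 : ℝ), |r * a| < ε :=
    ((by fun_prop : Continuous fun r : ℝ => |r * a|).tendsto' 0 0 (by simp)).eventually
      (gt_mem_nhds hε) |>.filter_mono nhdsWithin_le_nhds
  have e2 : ∀ᶠ r in 𝓝[>] (0 : ℝ), |r * b| < ε :=
    ((by fun_prop : Continuous fun r : ℝ => |r * b|).tendsto' 0 0 (by simp)).eventually
      (gt_mem_nhds hε) |>.filter_mono nhdsWithin_le_nhds
  obtain ⟨r, h1, h2, hr, hr'⟩ := (e1.and (e2.and (Ioo_mem_nhdsGT hε'))).exists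
  have p1 := (H' 0 r (by simpa using hε') (abs_lt.2 ⟨by linarith, hr'⟩)).1 hr
  have p2 := (H' 0 (-r) (by simpa using hε') (abs_lt.2 ⟨by linarith, by linarith⟩)).2 (by linarith)
  have q1 := H (r * a) (r * b) h1 h2
  have q2 := H (-r * a) (-r * b) (by rwa [neg_mul, abs_neg]) (by rwa [neg_mul, abs_neg])
  simp only [zero_smul, add_zero, smul_add, smul_smul, ← add_assoc] at p1 p2
  rcases lt_or_gt_of_ne hb with hb | hb
  · rw [(q1.2 (mul_neg_of_pos_of_neg hr hb)).unique p1,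
      (q2.1 (mul_pos_of_neg_of_neg (by linarith) hb)).unique p2, add_comm]
  · rw [(q1.1 (mul_pos hr hb)).unique p1,
      (q2.2 (mul_neg_of_neg_of_pos (by linarith) hb)).unique p2]

end KnotDiagram

namespace KnotDiagram

variable {D : KnotDiagram}

theorem IsRegionAt.unique {c d : ℝ × ℝ} {R R' : D.Region} (h : D.IsRegionAt c d R)
    (h' : D.IsRegionAt c d R') : R = R' := by
  obtain ⟨ε, hε, H⟩ := h
  obtain ⟨ε', hε', H'⟩ := h'
  have hm : 0 < min ε ε' := lt_min hε hε'
  exact InRegion.unique (D := D)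
    (H (min ε ε' / 2) (by linarith) (by linarith [min_le_left ε ε']))
    (H' (min ε ε' / 2) (by linarith) (by linarith [min_le_right ε ε']))

theorem CrossModel.regionsAround {i j : ZMod D.n} {s t : ℝ} (h : D.IsCrossing i s j t)
    {R₁ R₂ R₃ R₄ : D.Region}
    (hR : D.CrossModel (D.planePoint i s) (D.dir i) (D.dir j) R₁ R₂ R₃ R₄) :
    D.RegionsAround i s j t R₁ R₂ R₃ R₄ := by
  obtain ⟨ε, hε, H⟩ := hR
  have abs_lt' : ∀ r : ℝ, 0 < r → r < ε → |r| < ε ∧ |-r| < ε := fun r h0 h1 => by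
    rw [abs_neg, abs_of_pos h0]; exact ⟨h1, h1⟩
  refine ⟨h, ?_⟩
  rw [point_fst]
  refine ⟨⟨ε, hε, fun r h0 h1 => ?_⟩, ⟨ε, hε, fun r h0 h1 => ?_⟩, ⟨ε, hε, fun r h0 h1 => ?_⟩,
    ⟨ε, hε, fun r h0 h1 => ?_⟩⟩ <;> obtain ⟨ha, hb⟩ := abs_lt' r h0 h1
  · have := (H r r ha ha).1 h0 h0
    rwa [add_assoc, ← smul_add] at this
  · have := (H (-r) r hb ha).2.1 (by linarith) h0
    rwa [add_assoc, neg_smul, ← smul_neg, ← smul_add] at this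
  · have := (H r (-r) ha hb).2.2.1 h0 (by linarith)
    rwa [add_assoc, neg_smul, ← smul_neg, ← smul_add, ← sub_eq_add_neg] at this
  · have := (H (-r) (-r) hb hb).2.2.2 (by linarith) (by linarith)
    rwa [add_assoc, neg_smul, neg_smul, ← smul_neg, ← smul_neg, ← smul_add, ← sub_eq_add_neg]
      at this

theorem IsCrossing.ne {i j : ZMod D.n} {s t : ℝ} (h : D.IsCrossing i s j t) :
    (i, s) ≠ (j, t) := by
  intro he
  obtain ⟨rfl, rfl⟩ := Prod.mk.inj he
  exact lt_irrefl _ h.2.2.2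

theorem isCrossing_or {i j : ZMod D.n} {s t : ℝ} (hs : s ∈ Set.Ico (0 : ℝ) 1)
    (ht : t ∈ Set.Ico (0 : ℝ) 1) (h : D.planePoint i s = D.planePoint j t)
    (hne : (i, s) ≠ (j, t)) : D.IsCrossing i s j t ∨ D.IsCrossing j t i s := by
  rw [← point_fst, ← point_fst] at h
  rcases lt_trichotomy (D.point i s).2 (D.point j t).2 with h' | h' | h'
  · exact Or.inr ⟨ht, hs, h.symm, h'⟩
  · obtain ⟨rfl, rfl⟩ := D.simple i j s t hs ht (Prod.ext h h')
    exact absurd rfl hne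
  · exact Or.inl ⟨hs, ht, h, h'⟩

/-- Every crossing of the projection, whichever strand is the upper one, relates the colors. -/
theorem color_sum_eq {C : D.Region → ZMod 2} (hC : D.IsDehnColoring 2 C) {i j : ZMod D.n}
    {s t : ℝ} (hs : s ∈ Set.Ico (0 : ℝ) 1) (ht : t ∈ Set.Ico (0 : ℝ) 1)
    (h : D.planePoint i s = D.planePoint j t) (hne : (i, s) ≠ (j, t)) {R₁ R₂ R₃ R₄ : D.Region}
    (hR : D.CrossModel (D.planePoint i s) (D.dir i) (D.dir j) R₁ R₂ R₃ R₄) :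
    C R₁ + C R₃ = C R₂ + C R₄ := by
  rcases isCrossing_or hs ht h hne with hc | hc
  · exact hC _ _ _ _ _ _ _ _ (hR.regionsAround hc)
  · rw [h] at hR
    have := hC _ _ _ _ _ _ _ _ (hR.swap.regionsAround hc)
    -- With the other strand on top the relation reads `C R₁ + C R₂ = C R₃ + C R₄`, which is
    -- equivalent modulo 2, where signs do not matter.
    revert this
    generalize C R₁ = a, C R₂ = b, C R₃ = c, C R₄ = d
    revert a b c d
    decide

theorem LineModel.sideSum {C : D.Region → ZMod 2} {i : ZMod D.n} {s r : ℝ} {w : ℝ × ℝ}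
    {R R' : D.Region} (hw : planeDet (D.dir i) w ≠ 0)
    (h : D.LineModel (D.planePoint i s + r • D.dir i) (D.dir i) w R R') :
    D.SideSum C i (s + r) (C R + C R') :=
  ⟨w, R, R', hw, by rwa [planePoint_add], rfl⟩

theorem planeDet_rotation_ne_zero {d : ℝ × ℝ} (hd : d ≠ 0) : planeDet d (-d.2, d.1) ≠ 0 := by
  intro h
  simp only [planeDet] at h
  have h0 := mul_self_add_mul_self_eq_zero.1 (show d.1 * d.1 + d.2 * d.2 = 0 by linarith)
  exact hd (Prod.ext h0.1 h0.2)

/-- At a crossing the relation equates the sum just ahead with the sum just behind. Away from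
crossings both sides are single regions. The parameter `s` itself is omitted because at a crossing
the strand does not have just two sides. -/
theorem exists_sideSum_interior {C : D.Region → ZMod 2} (hC : D.IsDehnColoring 2 C)
    (i : ZMod D.n) {s : ℝ} (hs : s ∈ Set.Ioo (0 : ℝ) 1) :
    ∃ δ, ∀ᶠ r in 𝓝[≠] (0 : ℝ), D.SideSum C i (s + r) δ := by
  have hs' : s ∈ Set.Ico (0 : ℝ) 1 := ⟨hs.1.le, hs.2⟩
  by_cases hcr : ∃ j t, t ∈ Set.Ico (0 : ℝ) 1 ∧ D.planePoint i s = D.planePoint j t ∧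
      (i, s) ≠ (j, t)
  · obtain ⟨j, t, ht, h, hne⟩ := hcr
    have hdet := (transverse_planePoint hs' ht h hne).2.2
    obtain ⟨R₁, R₂, R₃, R₄, hR⟩ := exists_crossModel hs' ht h hne
    refine ⟨C R₁ + C R₃, ?_⟩
    rw [← nhdsLT_sup_nhdsGT, eventually_sup]
    refine ⟨?_, hR.lineModel.1.mono fun r hr => hr.sideSum hdet⟩
    rw [color_sum_eq hC hs' ht h hne hR]
    exact hR.lineModel.2.mono fun r hr => hr.sideSum hdet
  · have hdet := planeDet_rotation_ne_zero (dir_ne_zero i)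
    obtain ⟨ε, hε, H⟩ := exists_square_edge_through (D := D) (D.planePoint i s) (D.dir i)
      (-(D.dir i).2, (D.dir i).1)
    obtain ⟨R, R', hR⟩ := exists_lineModel hε fun a b ha hb hab => by
      obtain ⟨k, u, hu, u', -, e, e'⟩ := H a b ha hb hab
      have hu' := edge_through_interior hs hu e
      have hk : (i, s) = (k, u) := by
        by_contra hne
        exact hcr ⟨k, u, hu', e.symm, hne⟩
      obtain ⟨rfl, rfl⟩ := Prod.mk.inj hk
      exact (coords_eq_zero hdet (a := a - (u' - s)) (b := b) (by rw [sub_smul, e']; abel)).2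
    exact ⟨C R + C R', (hR.shift.mono fun r hr => hr.sideSum hdet).filter_mono
      nhdsWithin_le_nhds⟩

/-- No crossing sits at a vertex, so the same two regions accompany the knot from the end of one
edge to the start of the next. When the edges are parallel a straight line is the local picture,
otherwise a corner. -/
theorem exists_sideSum_vertex (C : D.Region → ZMod 2) (k : ZMod D.n) :
    ∃ δ, (∀ᶠ r in 𝓝[>] (0 : ℝ), D.SideSum C (k + 1) (0 + r) δ) ∧
      ∀ᶠ r in 𝓝[<] (0 : ℝ), D.SideSum C k (1 + r) δ := by
  by_cases hdet : planeDet (D.dir k) (D.dir (k + 1)) = 0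
  · obtain ⟨l, hl⟩ := exists_smul_of_planeDet_eq_zero (dir_ne_zero k) hdet
    have hl0 : l ≠ 0 := by
      rintro rfl
      exact dir_ne_zero (k + 1) (by rw [hl, zero_smul])
    have hdet := planeDet_rotation_ne_zero (dir_ne_zero k)
    obtain ⟨ε, hε, H⟩ := exists_square_edge_through (D := D) (D.planePoint k 1) (D.dir k)
      (-(D.dir k).2, (D.dir k).1)
    obtain ⟨R, R', hR⟩ := exists_lineModel hε fun a b ha hb hab => by
      obtain ⟨k', u, hu, u', -, e, e'⟩ := H a b ha hb hab
      rw [planePoint_one] at e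
      have hm : ∃ m : ℝ, D.dir k' = m • D.dir k := by
        rcases edge_through_vertex hu e with ⟨rfl, -⟩ | ⟨h, -⟩
        · exact ⟨l, hl⟩
        · exact ⟨1, by rw [add_right_cancel h, one_smul]⟩
      obtain ⟨m, hm⟩ := hm
      rw [hm, smul_smul] at e'
      exact (coords_eq_zero hdet (a := a - (u' - u) * m) (b := b)
        (by rw [sub_smul, e']; abel)).2
    refine ⟨C R + C R', ?_, ?_⟩
    · have hR' := hR.smul hl0
      rw [← hl, planePoint_one] at hR'
      have hdet' : planeDet (D.dir (k + 1)) (-(D.dir k).2, (D.dir k).1) ≠ 0 := by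
        rw [hl]
        have : planeDet (l • D.dir k) (-(D.dir k).2, (D.dir k).1)
            = l * planeDet (D.dir k) (-(D.dir k).2, (D.dir k).1) := by
          simp only [planeDet, Prod.smul_fst, Prod.smul_snd, smul_eq_mul]; ring
        rw [this]
        exact mul_ne_zero hl0 hdet
      exact (hR'.shift.mono fun r hr => hr.sideSum hdet').filter_mono nhdsWithin_le_nhds
    · exact (hR.shift.mono fun r hr => hr.sideSum hdet).filter_mono nhdsWithin_le_nhds
  · have hdet1 : planeDet (-D.dir k) (D.dir (k + 1)) ≠ 0 := by
      intro h
      apply hdet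
      simp only [planeDet, Prod.fst_neg, Prod.snd_neg] at h ⊢
      linarith
    have hdet2 : planeDet (D.dir (k + 1)) (-D.dir k) ≠ 0 := by
      rwa [planeDet_swap, neg_ne_zero]
    have hdet3 : planeDet (D.dir k) (D.dir (k + 1)) ≠ 0 := hdet
    -- Seen from the vertex, the two edges leave in the directions `-D.dir k` and `D.dir (k + 1)`,
    -- so with this basis the shadow lies on the nonnegative half axes.
    obtain ⟨ε, hε, H⟩ := exists_square_edge_through (D := D) (D.planePoint k 1) (-D.dir k)
      (D.dir (k + 1))
    obtain ⟨R, R', hR⟩ := exists_cornerModel hε fun a b ha hb hab => by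
      obtain ⟨k', u, hu, u', hu', e, e'⟩ := H a b ha hb hab
      rw [planePoint_one] at e
      rcases edge_through_vertex hu e with ⟨rfl, rfl⟩ | ⟨h, rfl⟩
      · obtain ⟨h1, h2⟩ := coords_eq_zero hdet1 (a := a) (b := b - (u' - 0))
          (by rw [sub_smul, e']; abel)
        exact Or.inl ⟨h1, by linarith [hu'.1]⟩
      · obtain rfl := add_right_cancel h
        obtain ⟨h1, h2⟩ := coords_eq_zero hdet1 (a := a + (u' - 1)) (b := b)
          (by rw [add_smul, smul_neg, smul_neg, e', smul_neg]; abel)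
        exact Or.inr ⟨h2, by linarith [hu'.2]⟩
    refine ⟨C R + C R', ?_, ?_⟩
    · have hR' := hR.swap.lineModel
      rw [planePoint_one] at hR'
      exact hR'.mono fun r hr => hr.sideSum hdet2
    · have hneg : Tendsto (fun r : ℝ => -r) (𝓝[<] 0) (𝓝[>] 0) := by
        simpa using tendsto_neg_nhdsLT (a := (0 : ℝ))
      refine (hneg.eventually hR.lineModel).mono fun r hr => ?_
      have := hr.smul (l := -1) (by norm_num)
      rw [neg_smul_neg, neg_one_smul, neg_neg] at this
      exact this.sideSum hdet3

theorem eventually_add_iff {p : ℝ → Prop} {s : ℝ} {A : Set ℝ} :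
    (∀ᶠ r in 𝓝[(s + ·) ⁻¹' A] (0 : ℝ), p (s + r)) ↔ ∀ᶠ x in 𝓝[A] s, p x := by
  have := (Homeomorph.addLeft s).isOpenEmbedding.map_nhdsWithin_preimage_eq A 0
  simp only [Homeomorph.coe_addLeft, add_zero] at this
  rw [← this, eventually_map]

/-- The sum of the colors on the two sides is constant along an edge. -/
theorem exists_sideSum_edge {C : D.Region → ZMod 2} (hC : D.IsDehnColoring 2 C)
    (i : ZMod D.n) :
    ∃ δ, ∀ s ∈ Set.Ioo (0 : ℝ) 1, ∀ᶠ x in 𝓝[≠] s, D.SideSum C i x δ := by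
  have hex : ∀ s : ℝ, ∃ δ, s ∈ Set.Ioo (0 : ℝ) 1 → ∀ᶠ x in 𝓝[≠] s, D.SideSum C i x δ := by
    intro s
    by_cases hs : s ∈ Set.Ioo (0 : ℝ) 1
    · obtain ⟨δ, hδ⟩ := exists_sideSum_interior hC i hs
      refine ⟨δ, fun _ => eventually_add_iff.1 ?_⟩
      convert hδ using 2
      ext r; simp
    · exact ⟨0, fun h => absurd h hs⟩
  choose δ hδ using hex
  -- The locally chosen sums agree at nearby parameters because their punctured neighborhoods
  -- overlap. A locally constant function on an interval is constant.
  have hcont : ContinuousOn δ (Set.Ioo 0 1) := by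
    intro s hs
    refine (tendsto_const_nhds (x := δ s)).congr' ?_
    have h1 := eventually_eventually_nhdsWithin.2 (hδ s hs)
    rw [eventually_nhdsWithin_iff] at h1
    filter_upwards [nhdsWithin_le_nhds h1, self_mem_nhdsWithin] with y hy hy'
    by_cases hys : y = s
    · rw [hys]
    · have h2 := hy hys
      rw [isOpen_compl_singleton.nhdsWithin_eq hys] at h2
      obtain ⟨x, hx, hx'⟩ := ((h2.filter_mono nhdsWithin_le_nhds).and (hδ y hy')).exists
      exact hx.unique hx'
  refine ⟨δ (1 / 2), fun s hs => ?_⟩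
  rw [isPreconnected_Ioo.constant hcont (show (1 / 2 : ℝ) ∈ Set.Ioo 0 1 by norm_num) hs]
  exact hδ s hs

/-- Lets the constant of an edge be read off next to an endpoint, from one side only: `O` is the
half-line pointing into the edge. -/
theorem sideSum_edge_unique {C : D.Region → ZMod 2} {i : ZMod D.n} {δ δ' : ZMod 2}
    (h : ∀ s ∈ Set.Ioo (0 : ℝ) 1, ∀ᶠ x in 𝓝[≠] s, D.SideSum C i x δ) {O : Set ℝ} (hO : IsOpen O)
    {a : ℝ} (hf : ∃ᶠ y in 𝓝[O] a, y ∈ Set.Ioo (0 : ℝ) 1)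
    (h' : ∀ᶠ x in 𝓝[O] a, D.SideSum C i x δ') : δ = δ' := by
  obtain ⟨y, hy, hy', hyO⟩ := (hf.and_eventually
    ((eventually_eventually_nhdsWithin.2 h').and self_mem_nhdsWithin)).exists
  rw [hO.nhdsWithin_eq hyO] at hy'
  obtain ⟨x, hx, hx'⟩ := ((hy'.filter_mono nhdsWithin_le_nhds).and (h y hy)).exists
  exact hx'.unique hx

/-- The sum of the colors on the two sides is constant along the knot. -/
theorem exists_sideSum {C : D.Region → ZMod 2} (hC : D.IsDehnColoring 2 C) :
    ∃ δ, ∀ i, ∀ s ∈ Set.Ioo (0 : ℝ) 1, ∀ᶠ x in 𝓝[≠] s, D.SideSum C i x δ := by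
  choose δ hδ using fun i => exists_sideSum_edge hC i
  have hstep : ∀ k, δ (k + 1) = δ k := by
    intro k
    obtain ⟨η, h0, h1⟩ := exists_sideSum_vertex C k
    have e0 : δ (k + 1) = η := by
      refine sideSum_edge_unique (hδ (k + 1)) isOpen_Ioi (a := 0)
        (Eventually.frequently (Ioo_mem_nhdsGT one_pos)) (eventually_add_iff.1 ?_)
      convert h0 using 2
      ext r; simp
    have e1 : δ k = η := by
      refine sideSum_edge_unique (hδ k) isOpen_Iio (a := 1)
        (Eventually.frequently (Ioo_mem_nhdsLT one_pos)) (eventually_add_iff.1 ?_)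
      convert h1 using 2
      ext r; simp
    rw [e0, e1]
  -- Having one component enters here: repeated steps to the next edge reach every edge from edge 0.
  have hconst : ∀ m : ℕ, δ (m : ZMod D.n) = δ 0 := by
    intro m
    induction m with
    | zero => simp
    | succ m ih => rw [Nat.cast_succ, hstep, ih]
  refine ⟨δ 0, fun i => ?_⟩
  rw [← hconst i.val, ZMod.natCast_zmod_val]
  exact hδ i

theorem CrossModel.color_sum {C : D.Region → ZMod 2} {i : ZMod D.n} {s : ℝ} {w : ℝ × ℝ}
    {R₁ R₂ R₃ R₄ : D.Region} (hw : planeDet (D.dir i) w ≠ 0)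
    (hR : D.CrossModel (D.planePoint i s) (D.dir i) w R₁ R₂ R₃ R₄) {δ : ZMod 2}
    (h : ∀ᶠ x in 𝓝[≠] s, D.SideSum C i x δ) : C R₁ + C R₃ = δ := by
  have h1 : ∀ᶠ x in 𝓝[>] s, D.SideSum C i x (C R₁ + C R₃) := by
    refine eventually_add_iff.1 ?_
    convert hR.lineModel.1.mono fun r hr => hr.sideSum hw using 2
    ext r; simp
  obtain ⟨x, hx, hx'⟩ := (h1.and (h.filter_mono (nhdsWithin_mono s fun x hx => ne_of_gt hx))).exists
  exact hx.unique hx'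

/-- A knot diagram has only trivial Dehn `2`-colorings. -/
theorem isTrivial_of_two {C : D.Region → ZMod 2} (hC : D.IsDehnColoring 2 C) :
    D.IsTrivial C := by
  intro i s j t x₁ x₂ x₃ x₄ hx
  obtain ⟨hs, ht, h, -⟩ := hx.1
  have hne := hx.1.ne
  rw [point_fst, point_fst] at h
  obtain ⟨δ, hδ⟩ := exists_sideSum hC
  obtain ⟨R₁, R₂, R₃, R₄, hR⟩ := exists_crossModel hs ht h hne
  obtain ⟨-, y1, y2, y3, y4⟩ := hR.regionsAround hx.1
  obtain ⟨-, z1, z2, z3, z4⟩ := hx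
  rw [z1.unique y1, z2.unique y2, z3.unique y3, z4.unique y4]
  obtain ⟨hs0, ht0, hdet⟩ := transverse_planePoint hs ht h hne
  -- The sums `C R₁ + C R₃` and `C R₁ + C R₂` both equal the global constant, so `C R₂ = C R₃`; the
  -- crossing relation then gives `C R₁ = C R₄`.
  have e1 := hR.color_sum hdet (hδ i s ⟨lt_of_le_of_ne hs.1 hs0.symm, hs.2⟩)
  have e3 := color_sum_eq hC hs ht h hne hR
  rw [h] at hR
  have e2 := hR.swap.color_sum (by rwa [planeDet_swap, neg_ne_zero])
    (hδ j t ⟨lt_of_le_of_ne ht.1 ht0.symm, ht.2⟩)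
  clear hδ
  revert e1 e2 e3
  generalize C R₁ = a, C R₂ = b, C R₃ = c, C R₄ = d
  revert a b c d δ
  decide

/-- The lower bound for the number of colors. -/
theorem lt_two_pow_ncard_range {p : ℕ} (hp : p.Prime) (hodd : Odd p) {C : D.Region → ZMod p}
    (hC : D.IsDehnColoring p C) (hnt : ¬ D.IsTrivial C) :
    p < 2 ^ ((Set.range C).ncard - 1) := by
  have : Fact p.Prime := ⟨hp⟩
  have : Fintype (Set.range C) := Fintype.ofFinite _
  let c : D.Region → Set.range C := fun R => ⟨C R, R, rfl⟩
  -- Relations are recorded between colors, so the number of unknowns is the number of colors used.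
  -- A solution modulo 2 on the colors pulls back along `c` to a Dehn 2-coloring of the whole
  -- diagram.
  let Q : Set (Set.range C × Set.range C × Set.range C × Set.range C) :=
    {q | ∃ i s j t x₁ x₂ x₃ x₄, D.RegionsAround i s j t x₁ x₂ x₃ x₄ ∧ q = (c x₁, c x₂, c x₃, c x₄)}
  have hle := le_two_pow_of_relations Q Subtype.val
    (by
      rintro _ _ _ _ ⟨i, s, j, t, x₁, x₂, x₃, x₄, h, he⟩
      obtain ⟨rfl, rfl, rfl, rfl⟩ : _ ∧ _ ∧ _ ∧ _ := by simpa using he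
      exact hC _ _ _ _ _ _ _ _ h)
    (fun h => hnt fun i s j t x₁ x₂ x₃ x₄ hx => h _ _ _ _ ⟨i, s, j, t, x₁, x₂, x₃, x₄, hx, rfl⟩)
    (by
      rintro v hv _ _ _ _ ⟨i, s, j, t, x₁, x₂, x₃, x₄, h, he⟩
      obtain ⟨rfl, rfl, rfl, rfl⟩ : _ ∧ _ ∧ _ ∧ _ := by simpa using he
      exact isTrivial_of_two (C := v ∘ c)
        (fun i s j t x₁ x₂ x₃ x₄ h => hv _ _ _ _ ⟨i, s, j, t, x₁, x₂, x₃, x₄, h, rfl⟩)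
        _ _ _ _ _ _ _ _ h)
  rw [← Nat.card_eq_fintype_card, Nat.card_coe_set_eq] at hle
  -- Equality would make the odd prime `p` a power of 2.
  refine lt_of_le_of_ne hle fun he => ?_
  rcases Nat.eq_zero_or_pos ((Set.range C).ncard - 1) with h0 | h0
  · rw [h0, pow_zero] at he
    exact hp.one_lt.ne' he
  · have : Even p := by
      rw [he]
      exact (Nat.even_pow.2 ⟨even_two, h0.ne'⟩)
    exact (Nat.not_even_iff_odd.2 hodd) this

end KnotDiagram

/-! ### Rectilinear diagrams on the integer lattice -/

/-- A vertex of a lattice polygon: plane coordinates `x`, `y` and height `z`. -/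
structure LatticePoint where
  x : ℕ
  y : ℕ
  z : ℕ

/-- An edge of a lattice polygon. -/
structure LatticeEdge where
  src : LatticePoint
  tgt : LatticePoint

/-- Both `a` and `b` are less than `c` and `d`. -/
def below (a b c d : ℕ) : Bool := a.blt c && a.blt d && b.blt c && b.blt d

/-- The intervals with ends `a, b` and `c, d` are disjoint. -/
def apart (a b c d : ℕ) : Bool := below a b c d || below c d a b

/-- `c` lies strictly between `a` and `b`. -/
def strictlyBetween (a b c : ℕ) : Bool := (a.blt c && c.blt b) || (b.blt c && c.blt a)

/-- `c` lies between `a` and `b`. -/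
def weaklyBetween (a b c : ℕ) : Bool := (a.ble c && c.ble b) || (b.ble c && c.ble a)

namespace LatticePoint

/-- Equality of plane coordinates. -/
def samePlace (a b : LatticePoint) : Bool := a.x.beq b.x && a.y.beq b.y

/-- The point of space with the given coordinates. -/
def toSpace (a : LatticePoint) : Space := ((a.x, a.y), a.z)

end LatticePoint

namespace LatticeEdge

/-- The edge is horizontal. -/
def isH (e : LatticeEdge) : Bool := e.src.y.beq e.tgt.y && !e.src.x.beq e.tgt.x

/-- The edge is vertical in the plane. -/
def isV (e : LatticeEdge) : Bool := e.src.x.beq e.tgt.x && !e.src.y.beq e.tgt.y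

/-- The horizontal edge `h` and the vertical edge `v` cross in their interiors, with distinct
heights, and the colors of the four cells around the crossing satisfy the Dehn relation. -/
def coloredCrossing (p : ℕ) (col : ℕ → ℕ → ℕ) (h v : LatticeEdge) : Bool :=
  strictlyBetween h.src.x h.tgt.x v.src.x && strictlyBetween v.src.y v.tgt.y h.src.y &&
  -- The two cells on one side of the lower strand must have the same sum as the two cells on its
  -- other side. The strict inequalities above make `x` and `y` positive, so the subtractions are
  -- not truncated.
  (let x := v.src.x
   let y := h.src.y
   (below v.src.z v.tgt.z h.src.z h.tgt.z &&
      ((col x y + col x (y - 1)) % p).beq ((col (x - 1) y + col (x - 1) (y - 1)) % p)) ||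
   (below h.src.z h.tgt.z v.src.z v.tgt.z &&
      ((col x y + col (x - 1) y) % p).beq ((col x (y - 1) + col (x - 1) (y - 1)) % p)))

/-- A horizontal and a vertical edge are disjoint, or consecutive, or cross properly. -/
def perpOK (p : ℕ) (col : ℕ → ℕ → ℕ) (h v : LatticeEdge) : Bool :=
  apart h.src.x h.tgt.x v.src.x v.src.x || apart v.src.y v.tgt.y h.src.y h.src.y ||
  h.tgt.samePlace v.src || v.tgt.samePlace h.src || coloredCrossing p col h v

/-- Two distinct edges are parallel and disjoint, or perpendicular and in good position. -/
def pairOK (p : ℕ) (col : ℕ → ℕ → ℕ) (e e' : LatticeEdge) : Bool :=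
  if e.isH then
    if e'.isH then !e.src.y.beq e'.src.y || apart e.src.x e.tgt.x e'.src.x e'.tgt.x
    else perpOK p col e e'
  else
    if e'.isH then perpOK p col e' e
    else !e.src.x.beq e'.src.x || apart e.src.y e.tgt.y e'.src.y e'.tgt.y

end LatticeEdge

/-- The property `f` holds for each member of a list together with each later member. -/
def allPairs {α : Type*} (f : α → α → Bool) : List α → Bool
  | [] => true
  | e :: l => l.all (f e) && allPairs f l

/-- The property `f` holds for all numbers below a bound. -/
def allBelow : ℕ → (ℕ → Bool) → Bool
  | 0, _ => true
  | n + 1, f => f n && allBelow n f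

/-- The edges of the closed polygon with given vertices. -/
def latticeEdges (L : List LatticePoint) : List LatticeEdge :=
  List.zipWith LatticeEdge.mk L (L.rotate 1)

/-- The color of the unit cell `(X, Y)` is listed, and the cell is separated by an edge from its
right and upper neighbours if these have another color. -/
def cellOK (E : List LatticeEdge) (S : List ℕ) (col : ℕ → ℕ → ℕ) (X Y : ℕ) : Bool :=
  (S.any fun s => s.beq (col X Y)) &&
  ((col X Y).beq (col (X + 1) Y) || E.any fun e => e.src.x.beq (X + 1) && e.isV &&
    weaklyBetween e.src.y e.tgt.y Y && weaklyBetween e.src.y e.tgt.y (Y + 1)) &&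
  ((col X Y).beq (col X (Y + 1)) || E.any fun e => e.src.y.beq (Y + 1) && e.isH &&
    weaklyBetween e.src.x e.tgt.x X && weaklyBetween e.src.x e.tgt.x (X + 1))

/-- The horizontal edge `h` and the vertical edge `v` cross, with different colors in opposite
cells. -/
def nontrivialCrossing (p : ℕ) (col : ℕ → ℕ → ℕ) (h v : LatticeEdge) : Bool :=
  h.isH && v.isV && strictlyBetween h.src.x h.tgt.x v.src.x &&
    strictlyBetween v.src.y v.tgt.y h.src.y &&
  (let x := v.src.x
   let y := h.src.y
   !(col x y % p).beq (col (x - 1) (y - 1) % p) || !(col (x - 1) y % p).beq (col x (y - 1) % p))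

/-- The colored lattice polygon is a nontrivially Dehn colored knot diagram. -/
def latticeCheck (p M N : ℕ) (S : List ℕ) (L : List LatticePoint) (col : ℕ → ℕ → ℕ) : Bool :=
  let E := latticeEdges L
  Nat.ble 3 L.length && (E.all fun e => e.isH || e.isV) &&
  allPairs (LatticeEdge.pairOK p col) E &&
  (allBelow M fun X => allBelow N fun Y => cellOK E S col X Y) &&
  E.any fun h => E.any fun v => nontrivialCrossing p col h v

/-! ### Meaning of the Boolean checks -/

theorem below_iff {a b c d : ℕ} : below a b c d = true ↔ (a < c ∧ a < d) ∧ b < c ∧ b < d := by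
  simp only [below, Bool.and_eq_true, Nat.blt_eq, and_assoc]

theorem strictlyBetween_iff {a b c : ℕ} :
    strictlyBetween a b c = true ↔ (a < c ∧ c < b) ∨ (b < c ∧ c < a) := by
  simp only [strictlyBetween, Bool.and_eq_true, Bool.or_eq_true, Nat.blt_eq]

theorem weaklyBetween_iff {a b c : ℕ} :
    weaklyBetween a b c = true ↔ (a ≤ c ∧ c ≤ b) ∨ (b ≤ c ∧ c ≤ a) := by
  simp only [weaklyBetween, Bool.and_eq_true, Bool.or_eq_true, Nat.ble_eq]

theorem allPairs_iff {α : Type*} {f : α → α → Bool} {l : List α} :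
    allPairs f l = true ↔ l.Pairwise fun a b => f a b = true := by
  induction l with
  | nil => simp [allPairs]
  | cons a l ih => simp [allPairs, ih]

theorem allBelow_iff {n : ℕ} {f : ℕ → Bool} : allBelow n f = true ↔ ∀ k < n, f k = true := by
  induction n with
  | zero => simp [allBelow]
  | succ n ih =>
    simp only [allBelow, Bool.and_eq_true, ih]
    constructor
    · rintro ⟨h, h'⟩ k hk
      rcases Nat.lt_succ_iff_lt_or_eq.1 hk with hk | rfl
      exacts [h' k hk, h]
    · exact fun h => ⟨h n (Nat.lt_succ_self n), fun k hk => h k (hk.trans (Nat.lt_succ_self n))⟩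

/-- Linear interpolation between two natural numbers. -/
def interpolate (a b : ℕ) (s : ℝ) : ℝ := a + s * (b - a)

/-- Interpolated values stay between the ends, so comparing ends decides for all parameters. Heights
at a crossing can thus be compared without computing where the crossing lies on its edges. -/
theorem interpolate_lt_of_below {a b c d : ℕ} (h : below a b c d = true) {s t : ℝ}
    (hs : s ∈ Set.Ico (0 : ℝ) 1) (ht : t ∈ Set.Ico (0 : ℝ) 1) :
    interpolate a b s < interpolate c d t := by
  have key : ∀ {a b : ℕ} {c s : ℝ}, s ∈ Set.Ico (0 : ℝ) 1 → a < c → b < c → interpolate a b s < c := by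
    intro a b c s hs h1 h2
    simp only [interpolate]
    nlinarith [hs.1, hs.2]
  obtain ⟨⟨h1, h2⟩, h3, h4⟩ := below_iff.1 h
  have key' : ∀ {a b : ℕ} {c s : ℝ}, s ∈ Set.Ico (0 : ℝ) 1 → c < a → c < b → c < interpolate a b s := by
    intro a b c s hs h1 h2
    simp only [interpolate]
    nlinarith [hs.1, hs.2]
  exact key' ht (key hs (by exact_mod_cast h1) (by exact_mod_cast h3))
    (key hs (by exact_mod_cast h2) (by exact_mod_cast h4))

theorem interpolate_ne_of_apart {a b c d : ℕ} (h : apart a b c d = true) {s t : ℝ}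
    (hs : s ∈ Set.Ico (0 : ℝ) 1) (ht : t ∈ Set.Ico (0 : ℝ) 1) :
    interpolate a b s ≠ interpolate c d t := by
  rw [apart, Bool.or_eq_true] at h
  rcases h with h | h
  · exact (interpolate_lt_of_below h hs ht).ne
  · exact (interpolate_lt_of_below h ht hs).ne'

theorem interpolate_self (a : ℕ) (s : ℝ) : interpolate a a s = a := by
  simp [interpolate]

theorem interpolate_zero (a b : ℕ) : interpolate a b 0 = a := by
  simp [interpolate]

theorem interpolate_injective {a b : ℕ} (h : a ≠ b) {s t : ℝ}
    (he : interpolate a b s = interpolate a b t) : s = t := by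
  have : (b : ℝ) - a ≠ 0 := sub_ne_zero.2 fun e => h (by exact_mod_cast e.symm)
  simp only [interpolate] at he
  exact mul_right_cancel₀ this (by linarith)

theorem interpolate_ne_right {a b : ℕ} (h : a ≠ b) {s : ℝ} (hs : s < 1) :
    interpolate a b s ≠ b := by
  intro he
  have : interpolate a b s = interpolate a b 1 := by rw [he]; simp [interpolate]
  exact hs.ne (interpolate_injective h this)

theorem exists_interpolate_eq {a b c : ℕ} (h : strictlyBetween a b c = true) :
    ∃ s ∈ Set.Ico (0 : ℝ) 1, interpolate a b s = c := by
  have key : ((c : ℝ) - a) / (b - a) ∈ Set.Ico (0 : ℝ) 1 ∧ (b : ℝ) - a ≠ 0 := by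
    rcases strictlyBetween_iff.1 h with ⟨h1, h2⟩ | ⟨h1, h2⟩
    · have h1' : (a : ℝ) < c := by exact_mod_cast h1
      have h2' : (c : ℝ) < b := by exact_mod_cast h2
      exact ⟨⟨div_nonneg (by linarith) (by linarith),
        (div_lt_one (by linarith)).2 (by linarith)⟩, by linarith⟩
    · have h1' : (b : ℝ) < c := by exact_mod_cast h1
      have h2' : (c : ℝ) < a := by exact_mod_cast h2
      exact ⟨⟨div_nonneg_of_nonpos (by linarith) (by linarith),
        (div_lt_one_of_neg (by linarith)).2 (by linarith)⟩, by linarith⟩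
  refine ⟨_, key.1, ?_⟩
  rw [interpolate, div_mul_cancel₀ _ key.2]
  ring

namespace LatticeEdge

theorem isH_iff {e : LatticeEdge} : e.isH = true ↔ e.src.y = e.tgt.y ∧ e.src.x ≠ e.tgt.x := by
  simp only [isH, Bool.and_eq_true, Bool.not_eq_true', ← Bool.not_eq_true, Nat.beq_eq, ne_eq]

theorem isV_iff {e : LatticeEdge} : e.isV = true ↔ e.src.x = e.tgt.x ∧ e.src.y ≠ e.tgt.y := by
  simp only [isV, Bool.and_eq_true, Bool.not_eq_true', ← Bool.not_eq_true, Nat.beq_eq, ne_eq]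

/-- The point of the plane with parameter `s` on the edge. -/
def planePoint (e : LatticeEdge) (s : ℝ) : ℝ × ℝ :=
  (interpolate e.src.x e.tgt.x s, interpolate e.src.y e.tgt.y s)

theorem planePoint_injective {e : LatticeEdge} (he : e.isH = true ∨ e.isV = true) {s t : ℝ}
    (h : e.planePoint s = e.planePoint t) : s = t := by
  rcases he with he | he
  · exact interpolate_injective (isH_iff.1 he).2 (congrArg Prod.fst h)
  · exact interpolate_injective (isV_iff.1 he).2 (congrArg Prod.snd h)

theorem planePoint_of_isH {e : LatticeEdge} (h : e.isH = true) (s : ℝ) :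
    e.planePoint s = (interpolate e.src.x e.tgt.x s, (e.src.y : ℝ)) := by
  rw [planePoint, ← (isH_iff.1 h).1, interpolate_self]

theorem planePoint_of_isV {e : LatticeEdge} (h : e.isV = true) (s : ℝ) :
    e.planePoint s = ((e.src.x : ℝ), interpolate e.src.y e.tgt.y s) := by
  rw [planePoint, ← (isV_iff.1 h).1, interpolate_self]

/-- The other alternatives leave no common point: separated intervals are disjoint, and a shared
corner has parameter 1 on one of the edges, which the half-open range excludes. -/
theorem perpOK.coloredCrossing {p : ℕ} {col : ℕ → ℕ → ℕ} {h v : LatticeEdge} (hh : h.isH = true)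
    (hv : v.isV = true) (hp : perpOK p col h v = true) {s t : ℝ} (hs : s ∈ Set.Ico (0 : ℝ) 1)
    (ht : t ∈ Set.Ico (0 : ℝ) 1) (he : h.planePoint s = v.planePoint t) :
    coloredCrossing p col h v = true := by
  rw [planePoint_of_isH hh, planePoint_of_isV hv] at he
  have h1 := congrArg Prod.fst he
  have h2 := congrArg Prod.snd he
  dsimp only at h1 h2
  simp only [perpOK, Bool.or_eq_true] at hp
  rcases hp with (((hp | hp) | hp) | hp) | hp
  · exact absurd (h1.trans (interpolate_self _ t).symm) (interpolate_ne_of_apart hp hs ht)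
  · exact absurd (h2.symm.trans (interpolate_self _ s).symm) (interpolate_ne_of_apart hp ht hs)
  · simp only [LatticePoint.samePlace, Bool.and_eq_true, Nat.beq_eq] at hp
    rw [← hp.1] at h1
    exact absurd h1 (interpolate_ne_right (isH_iff.1 hh).2 hs.2)
  · simp only [LatticePoint.samePlace, Bool.and_eq_true, Nat.beq_eq] at hp
    rw [← hp.2] at h2
    exact absurd h2.symm (interpolate_ne_right (isV_iff.1 hv).2 ht.2)
  · exact hp

theorem pairOK.coloredCrossing {p : ℕ} {col : ℕ → ℕ → ℕ} {e e' : LatticeEdge}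
    (h : e.isH = true ∨ e.isV = true) (h' : e'.isH = true ∨ e'.isV = true)
    (hp : pairOK p col e e' = true) {s t : ℝ} (hs : s ∈ Set.Ico (0 : ℝ) 1)
    (ht : t ∈ Set.Ico (0 : ℝ) 1) (he : e.planePoint s = e'.planePoint t) :
    (e.isH = true ∧ e'.isV = true ∧ coloredCrossing p col e e' = true) ∨
      (e'.isH = true ∧ e.isV = true ∧ coloredCrossing p col e' e = true) := by
  have notV : ∀ {e : LatticeEdge}, e.isH = true ∨ e.isV = true → e.isH ≠ true → e.isV = true :=
    fun h hn => h.resolve_left hn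
  rw [pairOK] at hp
  split_ifs at hp with c c' c'
  · rw [planePoint_of_isH c, planePoint_of_isH c'] at he
    rw [Bool.or_eq_true] at hp
    rcases hp with hp | hp
    · have : e.src.y = e'.src.y := Nat.cast_injective (congrArg Prod.snd he)
      simp [this] at hp
    · exact absurd (congrArg Prod.fst he) (interpolate_ne_of_apart hp hs ht)
  · exact Or.inl ⟨c, notV h' c', perpOK.coloredCrossing c (notV h' c') hp hs ht he⟩
  · exact Or.inr ⟨c', notV h c, perpOK.coloredCrossing c' (notV h c) hp ht hs he.symm⟩
  · rw [planePoint_of_isV (notV h c), planePoint_of_isV (notV h' c')] at he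
    rw [Bool.or_eq_true] at hp
    rcases hp with hp | hp
    · have : e.src.x = e'.src.x := Nat.cast_injective (congrArg Prod.fst he)
      simp [this] at hp
    · exact absurd (congrArg Prod.snd he) (interpolate_ne_of_apart hp hs ht)

/-- The heights at a crossing. -/
def height (e : LatticeEdge) (s : ℝ) : ℝ := interpolate e.src.z e.tgt.z s

theorem coloredCrossing.height_lt {p : ℕ} {col : ℕ → ℕ → ℕ} {h v : LatticeEdge}
    (hc : LatticeEdge.coloredCrossing p col h v = true) {s t : ℝ} (hs : s ∈ Set.Ico (0 : ℝ) 1)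
    (ht : t ∈ Set.Ico (0 : ℝ) 1) :
    (v.height t < h.height s ∧ (col v.src.x h.src.y + col v.src.x (h.src.y - 1)) % p
        = (col (v.src.x - 1) h.src.y + col (v.src.x - 1) (h.src.y - 1)) % p) ∨
    (h.height s < v.height t ∧ (col v.src.x h.src.y + col (v.src.x - 1) h.src.y) % p
        = (col v.src.x (h.src.y - 1) + col (v.src.x - 1) (h.src.y - 1)) % p) := by
  simp only [LatticeEdge.coloredCrossing, Bool.and_eq_true, Bool.or_eq_true, Nat.beq_eq] at hc
  rcases hc.2 with ⟨h1, h2⟩ | ⟨h1, h2⟩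
  · exact Or.inl ⟨interpolate_lt_of_below h1 ht hs, h2⟩
  · exact Or.inr ⟨interpolate_lt_of_below h1 hs ht, h2⟩

theorem coloredCrossing.strictlyBetween {p : ℕ} {col : ℕ → ℕ → ℕ} {h v : LatticeEdge}
    (hc : LatticeEdge.coloredCrossing p col h v = true) :
    strictlyBetween h.src.x h.tgt.x v.src.x = true ∧
      strictlyBetween v.src.y v.tgt.y h.src.y = true := by
  simp only [LatticeEdge.coloredCrossing, Bool.and_eq_true] at hc
  exact hc.1

end LatticeEdge

/-! ### From a checked lattice polygon to a knot diagram -/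

/-- A lattice polygon with colored cells that passes the checks. -/
structure ColoredLatticePolygon (p : ℕ) where
  vertices : List LatticePoint
  color : ℕ → ℕ → ℕ
  width : ℕ
  height : ℕ
  colors : List ℕ
  -- This confines the check to a finite rectangle. It also covers points with negative coordinates,
  -- since their natural floor is 0.
  outer : ∀ X Y, X = 0 ∨ Y = 0 ∨ width ≤ X ∨ height ≤ Y → color X Y = color 0 0
  check : latticeCheck p (width + 1) (height + 1) colors vertices color = true

namespace ColoredLatticePolygon

variable {p : ℕ} (G : ColoredLatticePolygon p)

/-- The number of vertices. -/
def n : ℕ := G.vertices.length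

theorem three_le : 3 ≤ G.n := by
  have := G.check
  simp only [latticeCheck, Bool.and_eq_true, Nat.ble_eq] at this
  exact this.1.1.1.1

instance : NeZero G.n := ⟨by have := G.three_le; omega⟩

/-- The cyclically indexed vertices. -/
def vertex (i : ZMod G.n) : LatticePoint := G.vertices[i.val]'(ZMod.val_lt i)

/-- The cyclically indexed edges. -/
def edge (i : ZMod G.n) : LatticeEdge := ⟨G.vertex i, G.vertex (i + 1)⟩

theorem length_latticeEdges : (latticeEdges G.vertices).length = G.n := by
  simp [latticeEdges, n]

theorem edge_eq (i : ZMod G.n) : G.edge i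
    = (latticeEdges G.vertices)[i.val]'(by rw [length_latticeEdges]; exact ZMod.val_lt i) := by
  have : Fact (1 < G.n) := ⟨by have := G.three_le; omega⟩
  simp only [edge, vertex, latticeEdges, List.getElem_zipWith, List.getElem_rotate, ZMod.val_add,
    ZMod.val_one]
  rfl

theorem exists_edge_of_mem {e : LatticeEdge} (he : e ∈ latticeEdges G.vertices) :
    ∃ i, G.edge i = e := by
  obtain ⟨k, hk, rfl⟩ := List.getElem_of_mem he
  have hk' : k < G.n := by rwa [← length_latticeEdges]
  refine ⟨(k : ZMod G.n), ?_⟩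
  rw [edge_eq]
  congr 1
  exact ZMod.val_cast_of_lt hk'

theorem isH_or_isV (i : ZMod G.n) : (G.edge i).isH = true ∨ (G.edge i).isV = true := by
  have := G.check
  simp only [latticeCheck, Bool.and_eq_true, List.all_eq_true, Bool.or_eq_true] at this
  rw [edge_eq]
  exact this.1.1.1.2 _ (List.getElem_mem _)

/-- Different edges meet only at a crossing that passed the check. Simplicity of the polygon,
transversality, absence of triple points and the Dehn relations all rest on this. -/
theorem coloredCrossing {i j : ZMod G.n} (hij : i ≠ j) {s t : ℝ} (hs : s ∈ Set.Ico (0 : ℝ) 1)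
    (ht : t ∈ Set.Ico (0 : ℝ) 1) (he : (G.edge i).planePoint s = (G.edge j).planePoint t) :
    ((G.edge i).isH = true ∧ (G.edge j).isV = true ∧
        LatticeEdge.coloredCrossing p G.color (G.edge i) (G.edge j) = true) ∨
      ((G.edge j).isH = true ∧ (G.edge i).isV = true ∧
        LatticeEdge.coloredCrossing p G.color (G.edge j) (G.edge i) = true) := by
  have hch := G.check
  simp only [latticeCheck, Bool.and_eq_true, allPairs_iff, List.pairwise_iff_getElem] at hch
  have hpair := hch.1.1.2
  have hlt : ∀ i : ZMod G.n, i.val < (latticeEdges G.vertices).length := fun i => by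
    rw [length_latticeEdges]; exact ZMod.val_lt i
  rcases lt_or_gt_of_ne (fun h => hij (ZMod.val_injective _ h) : i.val ≠ j.val) with h | h
  · have := hpair i.val j.val (hlt i) (hlt j) h
    rw [← edge_eq, ← edge_eq] at this
    exact LatticeEdge.pairOK.coloredCrossing (G.isH_or_isV i) (G.isH_or_isV j) this hs ht he
  · have := hpair j.val i.val (hlt j) (hlt i) h
    rw [← edge_eq, ← edge_eq] at this
    exact (LatticeEdge.pairOK.coloredCrossing (G.isH_or_isV j) (G.isH_or_isV i) this ht hs
      he.symm).symm

theorem point_eq (i : ZMod G.n) (s : ℝ) :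
    AffineMap.lineMap (G.vertex i).toSpace (G.vertex (i + 1)).toSpace s
      = ((G.edge i).planePoint s, (G.edge i).height s) := by
  simp only [AffineMap.lineMap_apply, LatticePoint.toSpace, vsub_eq_sub, vadd_eq_add,
    LatticeEdge.planePoint, LatticeEdge.height, interpolate, edge]
  ext <;> simp [add_comm]

/-- The polygon in space. -/
def toPolygonalKnot : PolygonalKnot where
  n := G.n
  three_le := G.three_le
  vertex i := (G.vertex i).toSpace
  simple i j s t hs ht h := by
    rw [point_eq, point_eq] at h
    obtain ⟨h1, h2⟩ := Prod.mk.inj h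
    by_cases hij : i = j
    · subst hij
      exact ⟨rfl, LatticeEdge.planePoint_injective (G.isH_or_isV i) h1⟩
    · rcases G.coloredCrossing hij hs ht h1 with ⟨-, -, hc⟩ | ⟨-, -, hc⟩
      · rcases LatticeEdge.coloredCrossing.height_lt hc hs ht with ⟨h, -⟩ | ⟨h, -⟩ <;> linarith
      · rcases LatticeEdge.coloredCrossing.height_lt hc ht hs with ⟨h, -⟩ | ⟨h, -⟩ <;> linarith

theorem point_fst (i : ZMod G.n) (s : ℝ) :
    (G.toPolygonalKnot.point i s).1 = (G.edge i).planePoint s :=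
  congrArg Prod.fst (G.point_eq i s)

theorem point_snd (i : ZMod G.n) (s : ℝ) :
    (G.toPolygonalKnot.point i s).2 = (G.edge i).height s :=
  congrArg Prod.snd (G.point_eq i s)

theorem dir_of_isH {i : ZMod G.n} (h : (G.edge i).isH = true) :
    ∃ a : ℝ, a ≠ 0 ∧ G.toPolygonalKnot.dir i = (a, 0) := by
  obtain ⟨h1, h2⟩ := LatticeEdge.isH_iff.1 h
  refine ⟨((G.edge i).tgt.x : ℝ) - (G.edge i).src.x,
    sub_ne_zero.2 fun e => h2 (by exact_mod_cast e.symm), ?_⟩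
  ext
  · rfl
  · change ((G.edge i).tgt.y : ℝ) - (G.edge i).src.y = 0
    rw [h1, sub_self]

theorem dir_of_isV {i : ZMod G.n} (h : (G.edge i).isV = true) :
    ∃ b : ℝ, b ≠ 0 ∧ G.toPolygonalKnot.dir i = (0, b) := by
  obtain ⟨h1, h2⟩ := LatticeEdge.isV_iff.1 h
  refine ⟨((G.edge i).tgt.y : ℝ) - (G.edge i).src.y,
    sub_ne_zero.2 fun e => h2 (by exact_mod_cast e.symm), ?_⟩
  ext
  · change ((G.edge i).tgt.x : ℝ) - (G.edge i).src.x = 0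
    rw [h1, sub_self]
  · rfl

theorem ne_zero_of_strictlyBetween {a b c : ℕ} (h : strictlyBetween a b c = true) {s : ℝ}
    (he : interpolate a b s = c) : s ≠ 0 := by
  rintro rfl
  rw [interpolate_zero] at he
  have : a = c := by exact_mod_cast he
  rcases strictlyBetween_iff.1 h with h | h <;> omega

theorem crossing_params {h v : LatticeEdge} (hh : h.isH = true) (hv : v.isV = true)
    (hc : LatticeEdge.coloredCrossing p G.color h v = true) {s t : ℝ}
    (he : h.planePoint s = v.planePoint t) : s ≠ 0 ∧ t ≠ 0 := by
  rw [LatticeEdge.planePoint_of_isH hh, LatticeEdge.planePoint_of_isV hv] at he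
  obtain ⟨h1, h2⟩ := Prod.mk.inj he
  obtain ⟨h3, h4⟩ := LatticeEdge.coloredCrossing.strictlyBetween hc
  exact ⟨ne_zero_of_strictlyBetween h3 h1, ne_zero_of_strictlyBetween h4 h2.symm⟩

theorem not_isH_and_isV {e : LatticeEdge} (h : e.isH = true) (h' : e.isV = true) : False :=
  (LatticeEdge.isH_iff.1 h).2 (LatticeEdge.isV_iff.1 h').1

/-- The knot diagram of the polygon. -/
def toKnotDiagram : KnotDiagram where
  toPolygonalKnot := G.toPolygonalKnot
  transverse i j s t hs ht h hne := by
    replace h := ((G.point_fst i s).symm.trans h).trans (G.point_fst j t)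
    have hij : i ≠ j := by
      rintro rfl
      exact hne (by rw [LatticeEdge.planePoint_injective (G.isH_or_isV i) h])
    rw [← planeDet_ne_zero_iff]
    rcases G.coloredCrossing hij hs ht h with ⟨hh, hv, hc⟩ | ⟨hh, hv, hc⟩
    · obtain ⟨a, ha, e⟩ := G.dir_of_isH hh
      obtain ⟨b, hb, e'⟩ := G.dir_of_isV hv
      obtain ⟨h1, h2⟩ := G.crossing_params hh hv hc h
      exact ⟨h1, h2, by rw [e, e']; simp [planeDet, ha, hb]⟩
    · obtain ⟨a, ha, e⟩ := G.dir_of_isH hh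
      obtain ⟨b, hb, e'⟩ := G.dir_of_isV hv
      obtain ⟨h1, h2⟩ := G.crossing_params hh hv hc h.symm
      exact ⟨h2, h1, by rw [e, e']; simp [planeDet, ha, hb]⟩
  no_triple i j k s t u hs ht hu h h' := by
    replace h := ((G.point_fst i s).symm.trans h).trans (G.point_fst j t)
    replace h' := ((G.point_fst j t).symm.trans h').trans (G.point_fst k u)
    have same : ∀ {i j : ZMod G.n} {s t : ℝ}, (G.edge i).planePoint s = (G.edge j).planePoint t →
        i = j → (i, s) = (j, t) := by
      rintro i j s t h rfl
      rw [LatticeEdge.planePoint_injective (G.isH_or_isV i) h]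
    by_cases hij : i = j
    · exact Or.inl (same h hij)
    by_cases hjk : j = k
    · exact Or.inr (Or.inl (same h' hjk))
    by_cases hik : i = k
    · exact Or.inr (Or.inr (same (h.trans h') hik))
    exfalso
    -- Three edges meeting pairwise would be pairwise one horizontal and one vertical, which is
    -- impossible with two classes.
    rcases G.coloredCrossing hij hs ht h with ⟨a, b, -⟩ | ⟨a, b, -⟩ <;>
    rcases G.coloredCrossing hjk ht hu h' with ⟨c, d, -⟩ | ⟨c, d, -⟩ <;>
    rcases G.coloredCrossing hik hs hu (h.trans h') with ⟨e, f, -⟩ | ⟨e, f, -⟩ <;>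
    first
      | exact not_isH_and_isV a d
      | exact not_isH_and_isV c b
      | exact not_isH_and_isV a f
      | exact not_isH_and_isV c f
      | exact not_isH_and_isV e d
      | exact not_isH_and_isV e b

end ColoredLatticePolygon

/-! ### Cell colors as a locally constant function off the shadow -/

theorem KnotDiagram.planePoint_mem_shadow {D : KnotDiagram} (i : ZMod D.n) {s : ℝ}
    (hs : s ∈ Set.Icc (0 : ℝ) 1) : D.planePoint i s ∈ D.shadow := by
  rcases hs.2.lt_or_eq with h | rfl
  · exact mem_shadow.2 ⟨i, s, ⟨hs.1, h⟩, rfl⟩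
  · exact mem_shadow.2 ⟨i + 1, 0, by norm_num, (planePoint_one i).symm⟩

theorem exists_interpolate_eq_of_mem {a b Y : ℕ} (h : weaklyBetween a b Y = true)
    (h' : weaklyBetween a b (Y + 1) = true) {r : ℝ} (hr : (Y : ℝ) ≤ r) (hr' : r ≤ Y + 1) :
    ∃ s ∈ Set.Icc (0 : ℝ) 1, interpolate a b s = r := by
  have key : (r - a) / (b - a) ∈ Set.Icc (0 : ℝ) 1 ∧ (b : ℝ) - a ≠ 0 := by
    rw [weaklyBetween_iff] at h h'
    have hab : a ≤ Y ∧ Y + 1 ≤ b ∨ b ≤ Y ∧ Y + 1 ≤ a := by omega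
    rcases hab with ⟨h1, h2⟩ | ⟨h1, h2⟩
    · have h1' : (a : ℝ) ≤ Y := by exact_mod_cast h1
      have h2' : (Y : ℝ) + 1 ≤ b := by exact_mod_cast h2
      exact ⟨⟨div_nonneg (by linarith) (by linarith),
        (div_le_one (by linarith)).2 (by linarith)⟩, by linarith⟩
    · have h1' : (b : ℝ) ≤ Y := by exact_mod_cast h1
      have h2' : (Y : ℝ) + 1 ≤ a := by exact_mod_cast h2
      exact ⟨⟨div_nonneg_of_nonpos (by linarith) (by linarith),
        (div_le_one_of_neg (by linarith)).2 (by linarith)⟩, by linarith⟩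
  refine ⟨_, key.1, ?_⟩
  rw [interpolate, div_mul_cancel₀ _ key.2]
  ring

/-- The natural floor is locally constant except at positive integers, where it is one smaller on
the left. There is no jump at 0, since negative numbers have floor 0 as well. -/
theorem eventually_floor (a : ℝ) : ∀ᶠ a' in 𝓝 a,
    ⌊a'⌋₊ = ⌊a⌋₊ ∨ (⌊a'⌋₊ + 1 = ⌊a⌋₊ ∧ a = (⌊a'⌋₊ : ℝ) + 1) := by
  have hup : ∀ᶠ a' in 𝓝 a, a' < (⌊a⌋₊ : ℝ) + 1 := gt_mem_nhds (Nat.lt_floor_add_one a)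
  rcases h : ⌊a⌋₊ with _ | k
  · filter_upwards [hup] with a' ha'
    left
    rw [h] at ha'
    exact Nat.floor_eq_zero.2 (by simpa using ha')
  · have ha : (k : ℝ) + 1 ≤ a := by
      have := (Nat.le_floor_iff' (by omega)).1 h.ge
      exact_mod_cast this
    rw [h] at hup
    push_cast at hup
    rcases ha.lt_or_eq with ha | ha
    · filter_upwards [hup, lt_mem_nhds ha] with a' h1 h2
      left
      rw [Nat.floor_eq_iff ((by positivity : (0 : ℝ) ≤ k + 1).trans h2.le)]
      push_cast
      exact ⟨h2.le, h1⟩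
    · filter_upwards [hup, lt_mem_nhds (show (k : ℝ) < a by linarith)] with a' h1 h2
      have h0 : (0 : ℝ) ≤ a' := (Nat.cast_nonneg k).trans h2.le
      rcases le_or_gt ((k : ℝ) + 1) a' with h3 | h3
      · left
        rw [Nat.floor_eq_iff h0]
        push_cast
        exact ⟨h3, h1⟩
      · right
        have : ⌊a'⌋₊ = k := (Nat.floor_eq_iff h0).2 ⟨h2.le, h3⟩
        rw [this]
        exact ⟨rfl, ha.symm⟩

theorem floor_le_or_eq_zero (b : ℝ) : ((⌊b⌋₊ : ℝ) ≤ b ∨ ⌊b⌋₊ = 0) := by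
  rcases le_or_gt 0 b with h | h
  · exact Or.inl (Nat.floor_le h)
  · exact Or.inr (Nat.floor_of_nonpos h.le)

/-- The index of the interval that one enters from `X` in the direction of `a`. -/
noncomputable def sideIndex (X : ℕ) (a : ℝ) : ℕ := if 0 < a then X else X - 1

theorem floor_add_mul {X : ℕ} (hX : 1 ≤ X) {a r : ℝ} (ha : a ≠ 0) (hr : 0 < r)
    (h : r * |a| < 1) : ⌊(X : ℝ) + r * a⌋₊ = sideIndex X a := by
  have hX' : (1 : ℝ) ≤ X := by exact_mod_cast hX
  rw [sideIndex]
  split_ifs with h0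
  · rw [abs_of_pos h0] at h
    have := mul_pos hr h0
    rw [Nat.floor_eq_iff (by linarith)]
    constructor <;> linarith
  · have h1 : a < 0 := lt_of_le_of_ne (not_lt.1 h0) ha
    rw [abs_of_neg h1] at h
    have := mul_pos hr (neg_pos.2 h1)
    rw [Nat.floor_eq_iff (by linarith)]
    push_cast [Nat.cast_sub hX]
    constructor <;> linarith

namespace ColoredLatticePolygon

variable {p : ℕ} (G : ColoredLatticePolygon p)

theorem planePoint_eq (i : ZMod G.n) (s : ℝ) :
    G.toKnotDiagram.planePoint i s = (G.edge i).planePoint s :=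
  (KnotDiagram.point_fst (D := G.toKnotDiagram) i s).symm.trans (G.point_fst i s)

theorem cellOK {X Y : ℕ} (hX : X < G.width + 1) (hY : Y < G.height + 1) :
    cellOK (latticeEdges G.vertices) G.colors G.color X Y = true := by
  have := G.check
  simp only [latticeCheck, Bool.and_eq_true, allBelow_iff] at this
  exact this.1.2 X hX Y hY

theorem color_mem (X Y : ℕ) : G.color X Y ∈ G.colors := by
  have key : ∀ X Y, X < G.width + 1 → Y < G.height + 1 → G.color X Y ∈ G.colors := by
    intro X Y hX hY
    have := G.cellOK hX hY
    simp only [_root_.cellOK, Bool.and_eq_true, List.any_eq_true, Nat.beq_eq] at this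
    obtain ⟨s, hs, e⟩ := this.1.1
    rwa [← e]
  by_cases h : X < G.width + 1 ∧ Y < G.height + 1
  · exact key X Y h.1 h.2
  · rw [G.outer X Y (by omega)]
    exact key 0 0 (by omega) (by omega)

/-- A colored plane point. -/
noncomputable def colorAt (x : ℝ × ℝ) : ℕ := G.color ⌊x.1⌋₊ ⌊x.2⌋₊

/-- If the colors differed, the check would provide an edge covering the common side of the two
cells, and `x` lies on that side. For `Y = 0`, where `x` may have a negative coordinate, both cells
are outer. -/
theorem color_succ_left {x : ℝ × ℝ} (hx : x ∉ G.toKnotDiagram.shadow) {X Y : ℕ}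
    (hX : x.1 = X + 1) (hY : (Y : ℝ) ≤ x.2 ∨ Y = 0) (hY' : x.2 ≤ Y + 1) :
    G.color X Y = G.color (X + 1) Y := by
  rcases hY with hY | rfl
  · by_contra hne
    have hXw : X < G.width + 1 := by
      by_contra h
      exact hne ((G.outer X Y (by omega)).trans (G.outer (X + 1) Y (by omega)).symm)
    have hYh : Y < G.height + 1 := by
      by_contra h
      exact hne ((G.outer X Y (by omega)).trans (G.outer (X + 1) Y (by omega)).symm)
    have := G.cellOK hXw hYh
    simp only [_root_.cellOK, Bool.and_eq_true, Bool.or_eq_true, List.any_eq_true,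
      Nat.beq_eq] at this
    obtain ⟨e, he, ⟨⟨hex, hv⟩, h1⟩, h2⟩ := this.1.2.resolve_left hne
    obtain ⟨i, rfl⟩ := G.exists_edge_of_mem he
    obtain ⟨s, hs, hsx⟩ := exists_interpolate_eq_of_mem h1 h2 hY hY'
    apply hx
    have hmem := KnotDiagram.planePoint_mem_shadow (D := G.toKnotDiagram) i hs
    rw [planePoint_eq, LatticeEdge.planePoint_of_isV hv, hsx, hex] at hmem
    convert hmem
    rw [hX]; push_cast; rfl
  · exact (G.outer X 0 (by omega)).trans (G.outer (X + 1) 0 (by omega)).symm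

theorem color_succ_right {x : ℝ × ℝ} (hx : x ∉ G.toKnotDiagram.shadow) {X Y : ℕ}
    (hY : x.2 = Y + 1) (hX : (X : ℝ) ≤ x.1 ∨ X = 0) (hX' : x.1 ≤ X + 1) :
    G.color X Y = G.color X (Y + 1) := by
  rcases hX with hX | rfl
  · by_contra hne
    have hXw : X < G.width + 1 := by
      by_contra h
      exact hne ((G.outer X Y (by omega)).trans (G.outer X (Y + 1) (by omega)).symm)
    have hYh : Y < G.height + 1 := by
      by_contra h
      exact hne ((G.outer X Y (by omega)).trans (G.outer X (Y + 1) (by omega)).symm)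
    have := G.cellOK hXw hYh
    simp only [_root_.cellOK, Bool.and_eq_true, Bool.or_eq_true, List.any_eq_true,
      Nat.beq_eq] at this
    obtain ⟨e, he, ⟨⟨hey, hh⟩, h1⟩, h2⟩ := this.2.resolve_left hne
    obtain ⟨i, rfl⟩ := G.exists_edge_of_mem he
    obtain ⟨s, hs, hsx⟩ := exists_interpolate_eq_of_mem h1 h2 hX hX'
    apply hx
    have hmem := KnotDiagram.planePoint_mem_shadow (D := G.toKnotDiagram) i hs
    rw [planePoint_eq, LatticeEdge.planePoint_of_isH hh, hsx, hey] at hmem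
    convert hmem
    rw [hY]; push_cast; rfl
  · exact (G.outer 0 Y (by omega)).trans (G.outer 0 (Y + 1) (by omega)).symm

/-- From the cell of `x'` one goes to the cell of `x` first horizontally in the row of `x'`, then
vertically in the column of `x`. Any grid line crossed on the way passes through `x`. -/
theorem eventually_colorAt_eq {x : ℝ × ℝ} (hx : x ∉ G.toKnotDiagram.shadow) :
    ∀ᶠ x' in 𝓝 x, G.colorAt x' = G.colorAt x := by
  filter_upwards [continuousAt_fst.eventually (eventually_floor x.1),
    continuousAt_snd.eventually (eventually_floor x.2)] with x' h1 h2
  have hleft : G.color ⌊x'.1⌋₊ ⌊x'.2⌋₊ = G.color ⌊x.1⌋₊ ⌊x'.2⌋₊ := by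
    rcases h1 with h1 | ⟨h1, h1'⟩
    · rw [h1]
    · rw [← h1]
      rcases h2 with h2 | ⟨h2, h2'⟩
      · rw [h2]
        exact G.color_succ_left hx h1' (floor_le_or_eq_zero _) (Nat.lt_floor_add_one _).le
      · exact G.color_succ_left hx h1' (Or.inl (by linarith)) (by linarith)
  have hright : G.color ⌊x.1⌋₊ ⌊x'.2⌋₊ = G.color ⌊x.1⌋₊ ⌊x.2⌋₊ := by
    rcases h2 with h2 | ⟨h2, h2'⟩
    · rw [h2]
    · rw [← h2]
      exact G.color_succ_right hx h2' (floor_le_or_eq_zero _) (Nat.lt_floor_add_one _).le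
  exact hleft.trans hright

/-- Continuity into the discrete space `ℕ` is what lets the cell color factor through connected
components. -/
theorem continuous_colorAt :
    Continuous fun x : {x : ℝ × ℝ // x ∉ G.toKnotDiagram.shadow} => G.colorAt x := by
  refine continuous_iff_continuousAt.2 fun x => ?_
  refine tendsto_const_nhds.congr' ?_
  filter_upwards [continuous_subtype_val.continuousAt.eventually (G.eventually_colorAt_eq x.2)]
    with x' hx'
  exact hx'.symm

/-- The coloring of the regions. -/
noncomputable def coloring (R : G.toKnotDiagram.Region) : ZMod p :=
  (G.continuous_colorAt.connectedComponentsLift R : ℕ)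

theorem coloring_of_inRegion {x : ℝ × ℝ} {R : G.toKnotDiagram.Region}
    (h : G.toKnotDiagram.InRegion x R) : G.coloring R = (G.colorAt x : ZMod p) := by
  obtain ⟨hx, rfl⟩ := h
  rfl

theorem ncard_range_coloring_le : (Set.range G.coloring).ncard ≤ G.colors.length := by
  have hsub : Set.range G.coloring
      ⊆ ((G.colors.map (Nat.cast : ℕ → ZMod p)).toFinset : Set (ZMod p)) := by
    rintro _ ⟨R, rfl⟩
    obtain ⟨x, hx⟩ : ∃ x, G.toKnotDiagram.InRegion x R := by
      obtain ⟨x, hx⟩ := ConnectedComponents.surjective_coe R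
      exact ⟨x, x.2, hx⟩
    rw [G.coloring_of_inRegion hx, List.coe_toFinset, Set.mem_ofPred_eq]
    exact List.mem_map_of_mem (G.color_mem _ _)
  refine (Set.ncard_le_ncard hsub (Finset.finite_toSet _)).trans ?_
  rw [Set.ncard_coe_finset]
  exact (List.toFinset_card_le _).trans (by simp)

theorem coloring_of_isRegionAt {X Y : ℕ} (hX : 1 ≤ X) (hY : 1 ≤ Y) {a b : ℝ} (ha : a ≠ 0)
    (hb : b ≠ 0) {R : G.toKnotDiagram.Region}
    (h : G.toKnotDiagram.IsRegionAt ((X : ℝ), (Y : ℝ)) (a, b) R) :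
    G.coloring R = (G.color (sideIndex X a) (sideIndex Y b) : ZMod p) := by
  obtain ⟨ε, hε, H⟩ := h
  have e1 : ∀ c : ℝ, ∀ᶠ r in 𝓝[>] (0 : ℝ), r * |c| < 1 := fun c =>
    ((by fun_prop : Continuous fun r : ℝ => r * |c|).tendsto' 0 0 (by simp)).eventually
      (gt_mem_nhds one_pos) |>.filter_mono nhdsWithin_le_nhds
  obtain ⟨r, h1, h2, hr, hr'⟩ := ((e1 a).and ((e1 b).and (Ioo_mem_nhdsGT hε))).exists
  rw [G.coloring_of_inRegion (H r hr hr'), colorAt]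
  congr 2
  · exact floor_add_mul hX ha hr h1
  · exact floor_add_mul hY hb hr h2

end ColoredLatticePolygon

theorem sideIndex_of_pos {X : ℕ} {a : ℝ} (h : 0 < a) : sideIndex X a = X := if_pos h

theorem sideIndex_of_neg {X : ℕ} {a : ℝ} (h : a < 0) : sideIndex X a = X - 1 :=
  if_neg (not_lt.2 h.le)

theorem AmbientIsotopic.refl (K : Set Space) : AmbientIsotopic K K :=
  ⟨fun _ => Homeomorph.refl Space, continuous_snd, rfl, Set.image_id K⟩

/-! ### The cell coloring is a nontrivial Dehn coloring -/

namespace ColoredLatticePolygon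

variable {p : ℕ} (G : ColoredLatticePolygon p)

/-- The colors around a crossing are those of the four cells at the crossing. -/
theorem coloring_at_crossing {i j : ZMod G.n} (hh : (G.edge i).isH = true)
    (hv : (G.edge j).isV = true) (hx : strictlyBetween (G.edge i).src.x (G.edge i).tgt.x
      (G.edge j).src.x = true)
    (hy : strictlyBetween (G.edge j).src.y (G.edge j).tgt.y (G.edge i).src.y = true) {s t : ℝ}
    (he : (G.edge i).planePoint s = (G.edge j).planePoint t) {α β : ℝ} (hα : α ≠ 0) (hβ : β ≠ 0)
    {R : G.toKnotDiagram.Region}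
    (hR : G.toKnotDiagram.IsRegionAt ((G.edge i).planePoint s) (α, β) R) :
    G.coloring R = (G.color (sideIndex (G.edge j).src.x α) (sideIndex (G.edge i).src.y β) :
      ZMod p) := by
  have hc : (G.edge i).planePoint s = (((G.edge j).src.x : ℝ), ((G.edge i).src.y : ℝ)) := by
    refine Prod.ext ?_ ?_
    · rw [he, LatticeEdge.planePoint_of_isV hv]
    · rw [LatticeEdge.planePoint_of_isH hh]
  rw [hc] at hR
  refine G.coloring_of_isRegionAt ?_ ?_ hα hβ hR
  · rcases strictlyBetween_iff.1 hx with h | h <;> omega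
  · rcases strictlyBetween_iff.1 hy with h | h <;> omega

theorem isCrossing_iff {i j : ZMod G.n} {s t : ℝ} (h : G.toKnotDiagram.IsCrossing i s j t) :
    i ≠ j ∧ s ∈ Set.Ico (0 : ℝ) 1 ∧ t ∈ Set.Ico (0 : ℝ) 1 ∧
      (G.edge i).planePoint s = (G.edge j).planePoint t ∧
      (G.edge j).height t < (G.edge i).height s := by
  obtain ⟨hs, ht, he, hlt⟩ := h
  have he' := ((G.point_fst i s).symm.trans he).trans (G.point_fst j t)
  refine ⟨?_, hs, ht, he', ?_⟩
  · rintro rfl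
    obtain rfl := LatticeEdge.planePoint_injective (G.isH_or_isV i) he'
    exact lt_irrefl _ hlt
  · exact (G.point_snd j t).symm.trans_lt (hlt.trans_eq (G.point_snd i s))

theorem isDehnColoring : G.toKnotDiagram.IsDehnColoring p G.coloring := by
  intro i s j t x₁ x₂ x₃ x₄ hx
  obtain ⟨hc, h1, h2, h3, h4⟩ := hx
  obtain ⟨hij, hs, ht, he, hlt⟩ := G.isCrossing_iff hc
  have hcen : (G.toKnotDiagram.point i s).1 = (G.edge i).planePoint s := G.point_fst i s
  rw [hcen] at h1 h2 h3 h4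
  have cast_rel : ∀ {a b c d : ℕ}, (a + b) % p = (c + d) % p →
      (a : ZMod p) + b = c + d := fun h => by
    have := (ZMod.natCast_eq_natCast_iff' _ _ p).2 h
    push_cast at this
    exact this
  rcases G.coloredCrossing hij hs ht he with ⟨hh, hv, hcc⟩ | ⟨hh, hv, hcc⟩
  · obtain ⟨a, ha, ea⟩ : ∃ a : ℝ, a ≠ 0 ∧ G.toKnotDiagram.dir i = (a, 0) := G.dir_of_isH hh
    obtain ⟨b, hb, eb⟩ : ∃ b : ℝ, b ≠ 0 ∧ G.toKnotDiagram.dir j = (0, b) := G.dir_of_isV hv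
    rw [ea, eb] at h1 h2 h3 h4
    simp only [Prod.mk_add_mk, Prod.neg_mk, Prod.mk_sub_mk, add_zero, zero_add, sub_zero, zero_sub,
      neg_zero] at h1 h2 h3 h4
    obtain ⟨bx, hy⟩ := LatticeEdge.coloredCrossing.strictlyBetween hcc
    rw [G.coloring_at_crossing hh hv bx hy he ha hb h1,
      G.coloring_at_crossing hh hv bx hy he (neg_ne_zero.2 ha) hb h2,
      G.coloring_at_crossing hh hv bx hy he ha (neg_ne_zero.2 hb) h3,
      G.coloring_at_crossing hh hv bx hy he (neg_ne_zero.2 ha) (neg_ne_zero.2 hb) h4]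
    rcases LatticeEdge.coloredCrossing.height_lt hcc hs ht with ⟨-, hrel⟩ | ⟨h, -⟩
    · have := cast_rel hrel
      -- The orientations of the two edges only exchange cells in the relation, which at most
      -- changes its sign.
      rcases lt_or_gt_of_ne ha with ha | ha <;> rcases lt_or_gt_of_ne hb with hb | hb <;>
      simp only [sideIndex_of_pos, sideIndex_of_neg, ha, hb, Left.neg_neg_iff,
        Left.neg_pos_iff] <;>
      first
        | linear_combination this
        | linear_combination -this
    · exact absurd hlt h.not_gt
  · obtain ⟨a, ha, ea⟩ : ∃ a : ℝ, a ≠ 0 ∧ G.toKnotDiagram.dir j = (a, 0) := G.dir_of_isH hh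
    obtain ⟨b, hb, eb⟩ : ∃ b : ℝ, b ≠ 0 ∧ G.toKnotDiagram.dir i = (0, b) := G.dir_of_isV hv
    rw [ea, eb, he] at h1 h2 h3 h4
    simp only [Prod.mk_add_mk, Prod.neg_mk, Prod.mk_sub_mk, add_zero, zero_add, sub_zero, zero_sub,
      neg_zero] at h1 h2 h3 h4
    obtain ⟨bx, hy⟩ := LatticeEdge.coloredCrossing.strictlyBetween hcc
    rw [G.coloring_at_crossing hh hv bx hy he.symm ha hb h1,
      G.coloring_at_crossing hh hv bx hy he.symm ha (neg_ne_zero.2 hb) h2,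
      G.coloring_at_crossing hh hv bx hy he.symm (neg_ne_zero.2 ha) hb h3,
      G.coloring_at_crossing hh hv bx hy he.symm (neg_ne_zero.2 ha) (neg_ne_zero.2 hb) h4]
    rcases LatticeEdge.coloredCrossing.height_lt hcc ht hs with ⟨h, -⟩ | ⟨-, hrel⟩
    · exact absurd hlt h.not_gt
    · have := cast_rel hrel
      rcases lt_or_gt_of_ne ha with ha | ha <;> rcases lt_or_gt_of_ne hb with hb | hb <;>
      simp only [sideIndex_of_pos, sideIndex_of_neg, ha, hb, Left.neg_neg_iff,
        Left.neg_pos_iff] <;>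
      first
        | linear_combination this
        | linear_combination -this

theorem not_isTrivial : ¬ G.toKnotDiagram.IsTrivial G.coloring := by
  intro htriv
  have hch := G.check
  simp only [latticeCheck, Bool.and_eq_true, List.any_eq_true, nontrivialCrossing] at hch
  obtain ⟨h, hh, v, hv, ⟨⟨⟨h1, h2⟩, h3⟩, h4⟩, h5⟩ := hch.2
  obtain ⟨i, rfl⟩ := G.exists_edge_of_mem hh
  obtain ⟨j, rfl⟩ := G.exists_edge_of_mem hv
  obtain ⟨s, hs, es⟩ := exists_interpolate_eq h3
  obtain ⟨t, ht, et⟩ := exists_interpolate_eq h4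
  have he : (G.edge i).planePoint s = (G.edge j).planePoint t := by
    rw [LatticeEdge.planePoint_of_isH h1, LatticeEdge.planePoint_of_isV h2, es, et]
  have hij : i ≠ j := by
    rintro rfl
    exact not_isH_and_isV h1 h2
  suffices hsuff : (G.color (G.edge j).src.x (G.edge i).src.y : ZMod p)
        = G.color ((G.edge j).src.x - 1) ((G.edge i).src.y - 1) ∧
      (G.color ((G.edge j).src.x - 1) (G.edge i).src.y : ZMod p)
        = G.color (G.edge j).src.x ((G.edge i).src.y - 1) by
    rw [ZMod.natCast_eq_natCast_iff', ZMod.natCast_eq_natCast_iff'] at hsuff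
    simp [hsuff.1, hsuff.2] at h5
  obtain ⟨a, ha, ea⟩ : ∃ a : ℝ, a ≠ 0 ∧ G.toKnotDiagram.dir i = (a, 0) := G.dir_of_isH h1
  obtain ⟨b, hb, eb⟩ : ∃ b : ℝ, b ≠ 0 ∧ G.toKnotDiagram.dir j = (0, b) := G.dir_of_isV h2
  have he' : G.toKnotDiagram.planePoint i s = G.toKnotDiagram.planePoint j t := by
    rw [planePoint_eq, planePoint_eq, he]
  have hne : (i, s) ≠ (j, t) := fun e => hij (congrArg Prod.fst e)
  have hcen : (G.toKnotDiagram.point i s).1 = (G.edge i).planePoint s := G.point_fst i s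
  have hcen' : (G.toKnotDiagram.point j t).1 = (G.edge j).planePoint t := G.point_fst j t
  obtain ⟨R₁, R₂, R₃, R₄, hR⟩ := KnotDiagram.exists_crossModel (D := G.toKnotDiagram) hs ht he' hne
  -- The nontriviality check ignores heights. This suffices, since triviality equates both pairs of
  -- opposite cells whichever strand is on top.
  rcases KnotDiagram.isCrossing_or (D := G.toKnotDiagram) hs ht he' hne with hc | hc
  · have hreg := hR.regionsAround hc
    obtain ⟨t1, t2⟩ := htriv _ _ _ _ _ _ _ _ hreg
    obtain ⟨-, r1, r2, r3, r4⟩ := hreg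
    rw [hcen, ea, eb] at r1 r2 r3 r4
    simp only [Prod.mk_add_mk, Prod.neg_mk, Prod.mk_sub_mk, add_zero, zero_add, sub_zero, zero_sub,
      neg_zero] at r1 r2 r3 r4
    rw [G.coloring_at_crossing h1 h2 h3 h4 he ha hb r1,
      G.coloring_at_crossing h1 h2 h3 h4 he (neg_ne_zero.2 ha) (neg_ne_zero.2 hb) r4] at t1
    rw [G.coloring_at_crossing h1 h2 h3 h4 he (neg_ne_zero.2 ha) hb r2,
      G.coloring_at_crossing h1 h2 h3 h4 he ha (neg_ne_zero.2 hb) r3] at t2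
    rcases lt_or_gt_of_ne ha with ha | ha <;> rcases lt_or_gt_of_ne hb with hb | hb <;>
    simp only [sideIndex_of_pos, sideIndex_of_neg, ha, hb,
        Left.neg_neg_iff, Left.neg_pos_iff] at t1 t2 <;>
    constructor <;> first | assumption | (symm; assumption)
  · rw [he'] at hR
    have hreg := hR.swap.regionsAround hc
    obtain ⟨t1, t2⟩ := htriv _ _ _ _ _ _ _ _ hreg
    obtain ⟨-, r1, r2, r3, r4⟩ := hreg
    rw [hcen', ← he, ea, eb] at r1 r2 r3 r4
    simp only [Prod.mk_add_mk, Prod.neg_mk, Prod.mk_sub_mk, add_zero, zero_add, sub_zero, zero_sub,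
      neg_zero] at r1 r2 r3 r4
    rw [G.coloring_at_crossing h1 h2 h3 h4 he ha hb r1,
      G.coloring_at_crossing h1 h2 h3 h4 he (neg_ne_zero.2 ha) (neg_ne_zero.2 hb) r4] at t1
    rw [G.coloring_at_crossing h1 h2 h3 h4 he ha (neg_ne_zero.2 hb) r2,
      G.coloring_at_crossing h1 h2 h3 h4 he (neg_ne_zero.2 ha) hb r3] at t2
    rcases lt_or_gt_of_ne ha with ha | ha <;> rcases lt_or_gt_of_ne hb with hb | hb <;>
    simp only [sideIndex_of_pos, sideIndex_of_neg, ha, hb,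
        Left.neg_neg_iff, Left.neg_pos_iff] at t1 t2 <;>
    constructor <;> first | assumption | (symm; assumption)

end ColoredLatticePolygon

/-! ### The lower bound and its attainment -/

/-- Nontrivial Dehn `p`-colorings use at least `⌊log₂ p⌋ + 2` colors. -/
theorem KnotDiagram.log_add_two_le {p : ℕ} (hp : p.Prime) (hodd : Odd p) {D : KnotDiagram}
    {C : D.Region → ZMod p} (hC : D.IsDehnColoring p C) (hnt : ¬ D.IsTrivial C) :
    Nat.log 2 p + 2 ≤ (Set.range C).ncard := by
  have h := lt_two_pow_ncard_range hp hodd hC hnt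
  have h1 := Nat.log_lt_of_lt_pow hp.ne_zero h
  omega

/-- A colored lattice polygon with few colors realizes the lower bound. -/
theorem ColoredLatticePolygon.exists_knot {p : ℕ} (hp : p.Prime) (hodd : Odd p)
    (G : ColoredLatticePolygon p) (hG : G.colors.length ≤ Nat.log 2 p + 2) :
    ∃ K : Set Space, IsKnot K ∧ DehnColorable p K ∧
      mincolDehn p K = ⌊Real.logb 2 (p : ℝ)⌋₊ + 2 := by
  have hdiag : G.toKnotDiagram.IsDiagramOf G.toKnotDiagram.carrier := AmbientIsotopic.refl _
  have hcard : (Set.range G.coloring).ncard = Nat.log 2 p + 2 :=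
    le_antisymm (G.ncard_range_coloring_le.trans hG)
      (KnotDiagram.log_add_two_le hp hodd G.isDehnColoring G.not_isTrivial)
  refine ⟨G.toKnotDiagram.carrier, ⟨_, hdiag⟩,
    ⟨_, _, hdiag, G.isDehnColoring, G.not_isTrivial⟩, ?_⟩
  have hlog : ⌊Real.logb 2 (p : ℝ)⌋₊ = Nat.log 2 p := by
    exact_mod_cast Real.natFloor_logb_natCast 2 p
  rw [hlog]
  refine IsLeast.csInf_eq ⟨⟨_, _, hdiag, G.isDehnColoring, G.not_isTrivial, hcard⟩, ?_⟩
  rintro m ⟨D, C, -, hC, hnt, rfl⟩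
  exact KnotDiagram.log_add_two_le hp hodd hC hnt

/-! ### Closed braids

The strand of a closed braid in position `j` runs along the line `y = 2 * j` and is closed up by an
arc above the braid. A letter of the braid word occupies three columns of unit cells: the strand in
position `i` steps up to `y = 2 * i + 1`, runs below or above the descending strand, and steps up
to `y = 2 * i + 2`. The letter changes the color of the strip between the two strands. -/

/-- The color of the cell `(X, Y)` of a braid, where `c j` is the color of the strip above `j`
strands on the left, and a letter `(i, m)` of the word exchanges the strands `i` and `i + 1` and
changes the color of the strip between them to `m`. -/
def braidColor : List (ℕ × ℕ) → (ℕ → ℕ) → ℕ → ℕ → ℕ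
  | [], c, _, Y => c (Y / 2)
  -- The crossing is at the middle of the letter, at height `2 * i + 1`. The cells around it have
  -- colors `c (i - 1)` and `c i` on the left, `m` and `c (i + 1)` on the right, so the crossing
  -- relation determines `m` modulo `p`.
  | (i, _) :: _, c, 0, Y => if Y.beq (2 * i) then c (i - 1) else c (Y / 2)
  | (i, m) :: _, c, 1, Y =>
    if Y.beq (2 * i) then m else if Y.beq (2 * i + 1) then c (i + 1) else c (Y / 2)
  | (i, m) :: _, c, 2, Y => if (Y / 2).beq i then m else c (Y / 2)
  | (i, m) :: w, c, X + 3, Y => braidColor w (fun j => if j.beq i then m else c j) X Y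

/-- The color of the cell `(X, Y)` of the closure of a braid with `k` strands. -/
def closedBraidColor (k : ℕ) (w : List (ℕ × ℕ)) (c : List ℕ) (X Y : ℕ) : ℕ :=
  let W := 3 * w.length + k + 1
  if X.beq 0 || Y.beq 0 || (W + k).ble X || (3 * k).ble Y then c.getD 0 0
  else if Y.ble (2 * k) && (k.blt X && X.blt W) then
    braidColor w (fun j => c.getD j 0) (X - (k + 1)) Y
  -- Outside the braid the closing arcs are nested, and the index is the number of strands enclosing
  -- the cell, counted from the nearest side. The colors after the last letter must return to `c`,
  -- which the cell check enforces.
  else c.getD (min (min X (W + k - X)) (min (min (Y / 2) (3 * k - Y)) k)) 0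

theorem closedBraidColor_outer (k : ℕ) (w : List (ℕ × ℕ)) (c : List ℕ) (X Y : ℕ)
    (h : X = 0 ∨ Y = 0 ∨ 3 * w.length + k + 1 + k ≤ X ∨ 3 * k ≤ Y) :
    closedBraidColor k w c X Y = closedBraidColor k w c 0 0 := by
  have h' : (X.beq 0 || Y.beq 0 || (3 * w.length + k + 1 + k).ble X || (3 * k).ble Y) = true := by
    simp only [Bool.or_eq_true, Nat.beq_eq, Nat.ble_eq]
    tauto
  simp only [closedBraidColor]
  rw [if_pos h', if_pos (by rfl)]

/-- The colored diagram of a closed braid. -/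
def closedBraid (p k : ℕ) (w : List (ℕ × ℕ)) (c S : List ℕ) (L : List LatticePoint)
    (h : latticeCheck p (3 * w.length + k + 1 + k + 1) (3 * k + 1) S L (closedBraidColor k w c)
      = true) : ColoredLatticePolygon p where
  vertices := L
  color := closedBraidColor k w c
  width := 3 * w.length + k + 1 + k
  height := 3 * k
  colors := S
  outer := closedBraidColor_outer k w c
  check := h

/-- A diagram with 3 colors modulo 3. -/
def diagramModThree : ColoredLatticePolygon 3 :=
  closedBraid 3 3 [(1, 1), (2, 2), (2, 1), (2, 0)] [0, 1, 0, 0] [0, 1, 2] [⟨1, 2, 1⟩, ⟨4, 2, 1⟩,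
    ⟨4, 3, 0⟩, ⟨6, 3, 0⟩, ⟨6, 4, 1⟩, ⟨7, 4, 1⟩, ⟨7, 5, 0⟩, ⟨9, 5, 0⟩, ⟨9, 6, 1⟩, ⟨11, 6, 1⟩, ⟨11,
    4, 1⟩, ⟨13, 4, 1⟩, ⟨13, 5, 0⟩, ⟨15, 5, 0⟩, ⟨15, 6, 1⟩, ⟨17, 6, 1⟩, ⟨17, 7, 1⟩, ⟨3, 7, 1⟩, ⟨3,
    6, 1⟩, ⟨8, 6, 1⟩, ⟨8, 4, 1⟩, ⟨10, 4, 1⟩, ⟨10, 5, 0⟩, ⟨12, 5, 0⟩, ⟨12, 6, 1⟩, ⟨14, 6, 1⟩, ⟨14,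
    4, 1⟩, ⟨18, 4, 1⟩, ⟨18, 8, 1⟩, ⟨2, 8, 1⟩, ⟨2, 4, 1⟩, ⟨5, 4, 1⟩, ⟨5, 2, 1⟩, ⟨19, 2, 1⟩, ⟨19, 9,
    1⟩, ⟨1, 9, 1⟩] (by decide +kernel)

/-- A diagram with 4 colors modulo 5. -/
def diagramModFive : ColoredLatticePolygon 5 :=
  closedBraid 5 3 [(1, 1), (2, 2), (1, 0), (2, 0)] [1, 0, 0, 3] [0, 1, 2, 3] [⟨1, 2, 1⟩, ⟨4, 2,
    1⟩, ⟨4, 3, 2⟩, ⟨6, 3, 2⟩, ⟨6, 4, 1⟩, ⟨7, 4, 1⟩, ⟨7, 5, 0⟩, ⟨9, 5, 0⟩, ⟨9, 6, 1⟩, ⟨14, 6, 1⟩,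
    ⟨14, 4, 1⟩, ⟨18, 4, 1⟩, ⟨18, 8, 1⟩, ⟨2, 8, 1⟩, ⟨2, 4, 1⟩, ⟨5, 4, 1⟩, ⟨5, 2, 1⟩, ⟨10, 2, 1⟩,
    ⟨10, 3, 2⟩, ⟨12, 3, 2⟩, ⟨12, 4, 1⟩, ⟨13, 4, 1⟩, ⟨13, 5, 0⟩, ⟨15, 5, 0⟩, ⟨15, 6, 1⟩, ⟨17, 6,
    1⟩, ⟨17, 7, 1⟩, ⟨3, 7, 1⟩, ⟨3, 6, 1⟩, ⟨8, 6, 1⟩, ⟨8, 4, 1⟩, ⟨11, 4, 1⟩, ⟨11, 2, 1⟩, ⟨19, 2,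
    1⟩, ⟨19, 9, 1⟩, ⟨1, 9, 1⟩] (by decide +kernel)

/-- A diagram with 4 colors modulo 7. -/
def diagramModSeven : ColoredLatticePolygon 7 :=
  closedBraid 7 4 [(2, 1), (2, 2), (1, 0), (2, 4), (1, 4), (1, 1), (3, 4), (2, 0), (3, 2)] [1, 1,
    0, 2, 2] [0, 1, 2, 4] [⟨1, 2, 1⟩, ⟨11, 2, 1⟩, ⟨11, 3, 2⟩, ⟨13, 3, 2⟩, ⟨13, 4, 1⟩, ⟨14, 4, 1⟩,
    ⟨14, 5, 0⟩, ⟨16, 5, 0⟩, ⟨16, 6, 1⟩, ⟨23, 6, 1⟩, ⟨23, 7, 2⟩, ⟨25, 7, 2⟩, ⟨25, 8, 1⟩, ⟨30, 8,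
    1⟩, ⟨30, 6, 1⟩, ⟨34, 6, 1⟩, ⟨34, 10, 1⟩, ⟨3, 10, 1⟩, ⟨3, 6, 1⟩, ⟨6, 6, 1⟩, ⟨6, 4, 1⟩, ⟨8, 4,
    1⟩, ⟨8, 5, 0⟩, ⟨10, 5, 0⟩, ⟨10, 6, 1⟩, ⟨15, 6, 1⟩, ⟨15, 4, 1⟩, ⟨18, 4, 1⟩, ⟨18, 2, 1⟩, ⟨20, 2,
    1⟩, ⟨20, 3, 2⟩, ⟨22, 3, 2⟩, ⟨22, 4, 1⟩, ⟨26, 4, 1⟩, ⟨26, 5, 0⟩, ⟨28, 5, 0⟩, ⟨28, 6, 1⟩, ⟨29,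
    6, 1⟩, ⟨29, 7, 2⟩, ⟨31, 7, 2⟩, ⟨31, 8, 1⟩, ⟨33, 8, 1⟩, ⟨33, 9, 1⟩, ⟨4, 9, 1⟩, ⟨4, 8, 1⟩, ⟨24,
    8, 1⟩, ⟨24, 6, 1⟩, ⟨27, 6, 1⟩, ⟨27, 4, 1⟩, ⟨35, 4, 1⟩, ⟨35, 11, 1⟩, ⟨2, 11, 1⟩, ⟨2, 4, 1⟩, ⟨5,
    4, 1⟩, ⟨5, 5, 0⟩, ⟨7, 5, 0⟩, ⟨7, 6, 1⟩, ⟨9, 6, 1⟩, ⟨9, 4, 1⟩, ⟨12, 4, 1⟩, ⟨12, 2, 1⟩, ⟨17, 2,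
    1⟩, ⟨17, 3, 2⟩, ⟨19, 3, 2⟩, ⟨19, 4, 1⟩, ⟨21, 4, 1⟩, ⟨21, 2, 1⟩, ⟨36, 2, 1⟩, ⟨36, 12, 1⟩, ⟨1,
    12, 1⟩] (by decide +kernel)

/-- A diagram with 5 colors modulo 11. -/
def diagramModEleven : ColoredLatticePolygon 11 :=
  closedBraid 11 4 [(1, 2), (2, 1), (2, 2), (2, 3), (1, 0), (2, 6), (1, 6), (1, 1), (3, 6), (2,
    0), (3, 3)] [1, 1, 0, 3, 3] [0, 1, 2, 3, 6] [⟨1, 2, 1⟩, ⟨5, 2, 1⟩, ⟨5, 3, 2⟩, ⟨7, 3, 2⟩, ⟨7,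
    4, 1⟩, ⟨8, 4, 1⟩, ⟨8, 5, 0⟩, ⟨10, 5, 0⟩, ⟨10, 6, 1⟩, ⟨12, 6, 1⟩, ⟨12, 4, 1⟩, ⟨14, 4, 1⟩, ⟨14,
    5, 0⟩, ⟨16, 5, 0⟩, ⟨16, 6, 1⟩, ⟨21, 6, 1⟩, ⟨21, 4, 1⟩, ⟨24, 4, 1⟩, ⟨24, 2, 1⟩, ⟨26, 2, 1⟩,
    ⟨26, 3, 2⟩, ⟨28, 3, 2⟩, ⟨28, 4, 1⟩, ⟨32, 4, 1⟩, ⟨32, 5, 0⟩, ⟨34, 5, 0⟩, ⟨34, 6, 1⟩, ⟨35, 6,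
    1⟩, ⟨35, 7, 2⟩, ⟨37, 7, 2⟩, ⟨37, 8, 1⟩, ⟨39, 8, 1⟩, ⟨39, 9, 1⟩, ⟨4, 9, 1⟩, ⟨4, 8, 1⟩, ⟨30, 8,
    1⟩, ⟨30, 6, 1⟩, ⟨33, 6, 1⟩, ⟨33, 4, 1⟩, ⟨41, 4, 1⟩, ⟨41, 11, 1⟩, ⟨2, 11, 1⟩, ⟨2, 4, 1⟩, ⟨6, 4,
    1⟩, ⟨6, 2, 1⟩, ⟨17, 2, 1⟩, ⟨17, 3, 2⟩, ⟨19, 3, 2⟩, ⟨19, 4, 1⟩, ⟨20, 4, 1⟩, ⟨20, 5, 0⟩, ⟨22, 5,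
    0⟩, ⟨22, 6, 1⟩, ⟨29, 6, 1⟩, ⟨29, 7, 2⟩, ⟨31, 7, 2⟩, ⟨31, 8, 1⟩, ⟨36, 8, 1⟩, ⟨36, 6, 1⟩, ⟨40,
    6, 1⟩, ⟨40, 10, 1⟩, ⟨3, 10, 1⟩, ⟨3, 6, 1⟩, ⟨9, 6, 1⟩, ⟨9, 4, 1⟩, ⟨11, 4, 1⟩, ⟨11, 5, 0⟩, ⟨13,
    5, 0⟩, ⟨13, 6, 1⟩, ⟨15, 6, 1⟩, ⟨15, 4, 1⟩, ⟨18, 4, 1⟩, ⟨18, 2, 1⟩, ⟨23, 2, 1⟩, ⟨23, 3, 2⟩,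
    ⟨25, 3, 2⟩, ⟨25, 4, 1⟩, ⟨27, 4, 1⟩, ⟨27, 2, 1⟩, ⟨42, 2, 1⟩, ⟨42, 12, 1⟩, ⟨1, 12, 1⟩] (by
    decide +kernel)

/-- A diagram with 6 colors modulo 17. -/
def diagramModSeventeen : ColoredLatticePolygon 17 :=
  closedBraid 17 4 [(1, 2), (2, 1), (3, 5), (2, 4), (1, 0), (2, 9), (3, 9), (2, 1), (3, 5), (3,
    1), (2, 0)] [2, 0, 0, 1, 5] [0, 1, 2, 4, 5, 9] [⟨1, 2, 1⟩, ⟨5, 2, 1⟩, ⟨5, 3, 2⟩, ⟨7, 3, 2⟩,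
    ⟨7, 4, 1⟩, ⟨8, 4, 1⟩, ⟨8, 5, 2⟩, ⟨10, 5, 2⟩, ⟨10, 6, 1⟩, ⟨11, 6, 1⟩, ⟨11, 7, 0⟩, ⟨13, 7, 0⟩,
    ⟨13, 8, 1⟩, ⟨24, 8, 1⟩, ⟨24, 6, 1⟩, ⟨27, 6, 1⟩, ⟨27, 4, 1⟩, ⟨35, 4, 1⟩, ⟨35, 5, 2⟩, ⟨37, 5,
    2⟩, ⟨37, 6, 1⟩, ⟨40, 6, 1⟩, ⟨40, 10, 1⟩, ⟨3, 10, 1⟩, ⟨3, 6, 1⟩, ⟨9, 6, 1⟩, ⟨9, 4, 1⟩, ⟨14, 4,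
    1⟩, ⟨14, 5, 0⟩, ⟨16, 5, 0⟩, ⟨16, 6, 1⟩, ⟨21, 6, 1⟩, ⟨21, 4, 1⟩, ⟨26, 4, 1⟩, ⟨26, 5, 0⟩, ⟨28,
    5, 0⟩, ⟨28, 6, 1⟩, ⟨29, 6, 1⟩, ⟨29, 7, 2⟩, ⟨31, 7, 2⟩, ⟨31, 8, 1⟩, ⟨33, 8, 1⟩, ⟨33, 6, 1⟩,
    ⟨36, 6, 1⟩, ⟨36, 4, 1⟩, ⟨41, 4, 1⟩, ⟨41, 11, 1⟩, ⟨2, 11, 1⟩, ⟨2, 4, 1⟩, ⟨6, 4, 1⟩, ⟨6, 2, 1⟩,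
    ⟨17, 2, 1⟩, ⟨17, 3, 2⟩, ⟨19, 3, 2⟩, ⟨19, 4, 1⟩, ⟨20, 4, 1⟩, ⟨20, 5, 0⟩, ⟨22, 5, 0⟩, ⟨22, 6,
    1⟩, ⟨23, 6, 1⟩, ⟨23, 7, 2⟩, ⟨25, 7, 2⟩, ⟨25, 8, 1⟩, ⟨30, 8, 1⟩, ⟨30, 6, 1⟩, ⟨32, 6, 1⟩, ⟨32,
    7, 2⟩, ⟨34, 7, 2⟩, ⟨34, 8, 1⟩, ⟨39, 8, 1⟩, ⟨39, 9, 1⟩, ⟨4, 9, 1⟩, ⟨4, 8, 1⟩, ⟨12, 8, 1⟩, ⟨12,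
    6, 1⟩, ⟨15, 6, 1⟩, ⟨15, 4, 1⟩, ⟨18, 4, 1⟩, ⟨18, 2, 1⟩, ⟨42, 2, 1⟩, ⟨42, 12, 1⟩, ⟨1, 12, 1⟩]
    (by decide +kernel)

/-- A diagram with 6 colors modulo 19. -/
def diagramModNineteen : ColoredLatticePolygon 19 :=
  closedBraid 19 4 [(1, 2), (2, 1), (2, 2), (2, 3), (1, 0), (2, 6), (1, 14), (2, 14), (1, 1), (3,
    14), (3, 6), (2, 0), (3, 3)] [1, 1, 0, 3, 3] [0, 1, 2, 3, 6, 14] [⟨1, 2, 1⟩, ⟨5, 2, 1⟩, ⟨5, 3,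
    2⟩, ⟨7, 3, 2⟩, ⟨7, 4, 1⟩, ⟨8, 4, 1⟩, ⟨8, 5, 0⟩, ⟨10, 5, 0⟩, ⟨10, 6, 1⟩, ⟨12, 6, 1⟩, ⟨12, 4,
    1⟩, ⟨14, 4, 1⟩, ⟨14, 5, 0⟩, ⟨16, 5, 0⟩, ⟨16, 6, 1⟩, ⟨21, 6, 1⟩, ⟨21, 4, 1⟩, ⟨24, 4, 1⟩, ⟨24,
    2, 1⟩, ⟨29, 2, 1⟩, ⟨29, 3, 2⟩, ⟨31, 3, 2⟩, ⟨31, 4, 1⟩, ⟨38, 4, 1⟩, ⟨38, 5, 0⟩, ⟨40, 5, 0⟩,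
    ⟨40, 6, 1⟩, ⟨41, 6, 1⟩, ⟨41, 7, 2⟩, ⟨43, 7, 2⟩, ⟨43, 8, 1⟩, ⟨45, 8, 1⟩, ⟨45, 9, 1⟩, ⟨4, 9, 1⟩,
    ⟨4, 8, 1⟩, ⟨33, 8, 1⟩, ⟨33, 6, 1⟩, ⟨35, 6, 1⟩, ⟨35, 7, 2⟩, ⟨37, 7, 2⟩, ⟨37, 8, 1⟩, ⟨42, 8, 1⟩,
    ⟨42, 6, 1⟩, ⟨46, 6, 1⟩, ⟨46, 10, 1⟩, ⟨3, 10, 1⟩, ⟨3, 6, 1⟩, ⟨9, 6, 1⟩, ⟨9, 4, 1⟩, ⟨11, 4, 1⟩,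
    ⟨11, 5, 0⟩, ⟨13, 5, 0⟩, ⟨13, 6, 1⟩, ⟨15, 6, 1⟩, ⟨15, 4, 1⟩, ⟨18, 4, 1⟩, ⟨18, 2, 1⟩, ⟨23, 2,
    1⟩, ⟨23, 3, 2⟩, ⟨25, 3, 2⟩, ⟨25, 4, 1⟩, ⟨26, 4, 1⟩, ⟨26, 5, 0⟩, ⟨28, 5, 0⟩, ⟨28, 6, 1⟩, ⟨32,
    6, 1⟩, ⟨32, 7, 2⟩, ⟨34, 7, 2⟩, ⟨34, 8, 1⟩, ⟨36, 8, 1⟩, ⟨36, 6, 1⟩, ⟨39, 6, 1⟩, ⟨39, 4, 1⟩,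
    ⟨47, 4, 1⟩, ⟨47, 11, 1⟩, ⟨2, 11, 1⟩, ⟨2, 4, 1⟩, ⟨6, 4, 1⟩, ⟨6, 2, 1⟩, ⟨17, 2, 1⟩, ⟨17, 3, 2⟩,
    ⟨19, 3, 2⟩, ⟨19, 4, 1⟩, ⟨20, 4, 1⟩, ⟨20, 5, 0⟩, ⟨22, 5, 0⟩, ⟨22, 6, 1⟩, ⟨27, 6, 1⟩, ⟨27, 4,
    1⟩, ⟨30, 4, 1⟩, ⟨30, 2, 1⟩, ⟨48, 2, 1⟩, ⟨48, 12, 1⟩, ⟨1, 12, 1⟩] (by decide +kernel)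

/-- A diagram with 6 colors modulo 23. -/
def diagramModTwentyThree : ColoredLatticePolygon 23 :=
  closedBraid 23 4 [(1, 1), (1, 2), (1, 3), (2, 3), (3, 3), (3, 6), (2, 0), (1, 2), (1, 1), (3,
    12), (2, 12), (1, 12), (1, 0), (2, 0), (3, 6), (3, 0), (2, 0)] [1, 0, 0, 0, 6] [0, 1, 2, 3, 6,
    12] [⟨1, 2, 1⟩, ⟨5, 2, 1⟩, ⟨5, 3, 2⟩, ⟨7, 3, 2⟩, ⟨7, 4, 1⟩, ⟨9, 4, 1⟩, ⟨9, 2, 1⟩, ⟨11, 2, 1⟩,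
    ⟨11, 3, 2⟩, ⟨13, 3, 2⟩, ⟨13, 4, 1⟩, ⟨14, 4, 1⟩, ⟨14, 5, 2⟩, ⟨16, 5, 2⟩, ⟨16, 6, 1⟩, ⟨17, 6,
    1⟩, ⟨17, 7, 0⟩, ⟨19, 7, 0⟩, ⟨19, 8, 1⟩, ⟨21, 8, 1⟩, ⟨21, 6, 1⟩, ⟨24, 6, 1⟩, ⟨24, 4, 1⟩, ⟨27,
    4, 1⟩, ⟨27, 2, 1⟩, ⟨29, 2, 1⟩, ⟨29, 3, 0⟩, ⟨31, 3, 0⟩, ⟨31, 4, 1⟩, ⟨35, 4, 1⟩, ⟨35, 5, 2⟩,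
    ⟨37, 5, 2⟩, ⟨37, 6, 1⟩, ⟨45, 6, 1⟩, ⟨45, 4, 1⟩, ⟨53, 4, 1⟩, ⟨53, 5, 0⟩, ⟨55, 5, 0⟩, ⟨55, 6,
    1⟩, ⟨58, 6, 1⟩, ⟨58, 10, 1⟩, ⟨3, 10, 1⟩, ⟨3, 6, 1⟩, ⟨15, 6, 1⟩, ⟨15, 4, 1⟩, ⟨23, 4, 1⟩, ⟨23,
    5, 2⟩, ⟨25, 5, 2⟩, ⟨25, 6, 1⟩, ⟨32, 6, 1⟩, ⟨32, 7, 0⟩, ⟨34, 7, 0⟩, ⟨34, 8, 1⟩, ⟨48, 8, 1⟩,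
    ⟨48, 6, 1⟩, ⟨50, 6, 1⟩, ⟨50, 7, 2⟩, ⟨52, 7, 2⟩, ⟨52, 8, 1⟩, ⟨57, 8, 1⟩, ⟨57, 9, 1⟩, ⟨4, 9, 1⟩,
    ⟨4, 8, 1⟩, ⟨18, 8, 1⟩, ⟨18, 6, 1⟩, ⟨20, 6, 1⟩, ⟨20, 7, 0⟩, ⟨22, 7, 0⟩, ⟨22, 8, 1⟩, ⟨33, 8, 1⟩,
    ⟨33, 6, 1⟩, ⟨36, 6, 1⟩, ⟨36, 4, 1⟩, ⟨39, 4, 1⟩, ⟨39, 2, 1⟩, ⟨41, 2, 1⟩, ⟨41, 3, 0⟩, ⟨43, 3,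
    0⟩, ⟨43, 4, 1⟩, ⟨44, 4, 1⟩, ⟨44, 5, 2⟩, ⟨46, 5, 2⟩, ⟨46, 6, 1⟩, ⟨47, 6, 1⟩, ⟨47, 7, 2⟩, ⟨49,
    7, 2⟩, ⟨49, 8, 1⟩, ⟨51, 8, 1⟩, ⟨51, 6, 1⟩, ⟨54, 6, 1⟩, ⟨54, 4, 1⟩, ⟨59, 4, 1⟩, ⟨59, 11, 1⟩,
    ⟨2, 11, 1⟩, ⟨2, 4, 1⟩, ⟨6, 4, 1⟩, ⟨6, 2, 1⟩, ⟨8, 2, 1⟩, ⟨8, 3, 2⟩, ⟨10, 3, 2⟩, ⟨10, 4, 1⟩,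
    ⟨12, 4, 1⟩, ⟨12, 2, 1⟩, ⟨26, 2, 1⟩, ⟨26, 3, 0⟩, ⟨28, 3, 0⟩, ⟨28, 4, 1⟩, ⟨30, 4, 1⟩, ⟨30, 2,
    1⟩, ⟨38, 2, 1⟩, ⟨38, 3, 0⟩, ⟨40, 3, 0⟩, ⟨40, 4, 1⟩, ⟨42, 4, 1⟩, ⟨42, 2, 1⟩, ⟨60, 2, 1⟩, ⟨60,
    12, 1⟩, ⟨1, 12, 1⟩] (by decide +kernel)

/-- A diagram with 6 colors modulo 31. -/
def diagramModThirtyOne : ColoredLatticePolygon 31 :=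
  closedBraid 31 5 [(1, 1), (1, 2), (2, 2), (3, 2), (3, 4), (2, 0), (1, 1), (3, 8), (4, 8), (3,
    16), (2, 16), (1, 16), (1, 0), (2, 0), (3, 8), (3, 0), (2, 0), (4, 4)] [1, 0, 0, 0, 4, 4] [0,
    1, 2, 4, 8, 16] [⟨1, 2, 1⟩, ⟨6, 2, 1⟩, ⟨6, 3, 2⟩, ⟨8, 3, 2⟩, ⟨8, 4, 1⟩, ⟨10, 4, 1⟩, ⟨10, 2,
    1⟩, ⟨24, 2, 1⟩, ⟨24, 3, 0⟩, ⟨26, 3, 0⟩, ⟨26, 4, 1⟩, ⟨36, 4, 1⟩, ⟨36, 5, 2⟩, ⟨38, 5, 2⟩, ⟨38,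
    6, 1⟩, ⟨46, 6, 1⟩, ⟨46, 4, 1⟩, ⟨54, 4, 1⟩, ⟨54, 5, 0⟩, ⟨56, 5, 0⟩, ⟨56, 6, 1⟩, ⟨63, 6, 1⟩,
    ⟨63, 13, 1⟩, ⟨3, 13, 1⟩, ⟨3, 6, 1⟩, ⟨13, 6, 1⟩, ⟨13, 4, 1⟩, ⟨21, 4, 1⟩, ⟨21, 5, 2⟩, ⟨23, 5,
    2⟩, ⟨23, 6, 1⟩, ⟨27, 6, 1⟩, ⟨27, 7, 0⟩, ⟨29, 7, 0⟩, ⟨29, 8, 1⟩, ⟨30, 8, 1⟩, ⟨30, 9, 2⟩, ⟨32,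
    9, 2⟩, ⟨32, 10, 1⟩, ⟨58, 10, 1⟩, ⟨58, 8, 1⟩, ⟨62, 8, 1⟩, ⟨62, 12, 1⟩, ⟨4, 12, 1⟩, ⟨4, 8, 1⟩,
    ⟨16, 8, 1⟩, ⟨16, 6, 1⟩, ⟨18, 6, 1⟩, ⟨18, 7, 0⟩, ⟨20, 7, 0⟩, ⟨20, 8, 1⟩, ⟨28, 8, 1⟩, ⟨28, 6,
    1⟩, ⟨33, 6, 1⟩, ⟨33, 7, 0⟩, ⟨35, 7, 0⟩, ⟨35, 8, 1⟩, ⟨49, 8, 1⟩, ⟨49, 6, 1⟩, ⟨51, 6, 1⟩, ⟨51,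
    7, 2⟩, ⟨53, 7, 2⟩, ⟨53, 8, 1⟩, ⟨57, 8, 1⟩, ⟨57, 9, 2⟩, ⟨59, 9, 2⟩, ⟨59, 10, 1⟩, ⟨61, 10, 1⟩,
    ⟨61, 11, 1⟩, ⟨5, 11, 1⟩, ⟨5, 10, 1⟩, ⟨31, 10, 1⟩, ⟨31, 8, 1⟩, ⟨34, 8, 1⟩, ⟨34, 6, 1⟩, ⟨37, 6,
    1⟩, ⟨37, 4, 1⟩, ⟨40, 4, 1⟩, ⟨40, 2, 1⟩, ⟨42, 2, 1⟩, ⟨42, 3, 0⟩, ⟨44, 3, 0⟩, ⟨44, 4, 1⟩, ⟨45,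
    4, 1⟩, ⟨45, 5, 2⟩, ⟨47, 5, 2⟩, ⟨47, 6, 1⟩, ⟨48, 6, 1⟩, ⟨48, 7, 2⟩, ⟨50, 7, 2⟩, ⟨50, 8, 1⟩,
    ⟨52, 8, 1⟩, ⟨52, 6, 1⟩, ⟨55, 6, 1⟩, ⟨55, 4, 1⟩, ⟨64, 4, 1⟩, ⟨64, 14, 1⟩, ⟨2, 14, 1⟩, ⟨2, 4,
    1⟩, ⟨7, 4, 1⟩, ⟨7, 2, 1⟩, ⟨9, 2, 1⟩, ⟨9, 3, 2⟩, ⟨11, 3, 2⟩, ⟨11, 4, 1⟩, ⟨12, 4, 1⟩, ⟨12, 5,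
    2⟩, ⟨14, 5, 2⟩, ⟨14, 6, 1⟩, ⟨15, 6, 1⟩, ⟨15, 7, 0⟩, ⟨17, 7, 0⟩, ⟨17, 8, 1⟩, ⟨19, 8, 1⟩, ⟨19,
    6, 1⟩, ⟨22, 6, 1⟩, ⟨22, 4, 1⟩, ⟨25, 4, 1⟩, ⟨25, 2, 1⟩, ⟨39, 2, 1⟩, ⟨39, 3, 0⟩, ⟨41, 3, 0⟩,
    ⟨41, 4, 1⟩, ⟨43, 4, 1⟩, ⟨43, 2, 1⟩, ⟨65, 2, 1⟩, ⟨65, 15, 1⟩, ⟨1, 15, 1⟩] (by decide +kernel)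

theorem mainTheorem4 (p : ℕ) (hp : p.Prime) (hodd : Odd p) (hlt : p < 2 ^ 5)
    (h13 : p ≠ 13) (h29 : p ≠ 29) :
    ∃ K : Set Space, IsKnot K ∧ DehnColorable p K ∧
      mincolDehn p K = ⌊Real.logb 2 (p : ℝ)⌋₊ + 2 := by
  have hcases : p = 3 ∨ p = 5 ∨ p = 7 ∨ p = 11 ∨ p = 17 ∨ p = 19 ∨ p = 23 ∨ p = 31 := by
    have hodd' := Nat.odd_iff.1 hodd
    norm_num at hlt
    interval_cases p <;> revert hp <;> first | omega | norm_num
  rcases hcases with rfl | rfl | rfl | rfl | rfl | rfl | rfl | rfl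
  · exact diagramModThree.exists_knot hp hodd (by decide +kernel)
  · exact diagramModFive.exists_knot hp hodd (by decide +kernel)
  · exact diagramModSeven.exists_knot hp hodd (by decide +kernel)
  · exact diagramModEleven.exists_knot hp hodd (by decide +kernel)
  · exact diagramModSeventeen.exists_knot hp hodd (by decide +kernel)
  · exact diagramModNineteen.exists_knot hp hodd (by decide +kernel)
  · exact diagramModTwentyThree.exists_knot hp hodd (by decide +kernel)
  · exact diagramModThirtyOne.exists_knot hp hodd (by decide +kernel)
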